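/- Let $k$ be a finite field with $|k|=q$, and let $\widetilde Q$ be a finite acyclic quiver with vertex set $\{1,\dots,m\}$ and principal part $Q$, the full subquiver on $\{1,\dots,n\}$, where $n\le m$. Modules are finite-dimensional left modules over the path algebra $k\widetilde Q$, in which an arrow $i\to j$ acts on a module as a map from its component at $j$ to its component at $i$; thus $\dim_k\mathrm{Ext}^1(S_i,S_j)$ is the number of arrows $j\to i$. A $kQ$-module is a $k\widetilde Q$-module whose components at the vertices $n+1,\dots,m$ vanish. Define the $m\times n$ matrices $$\widetilde b_{ij}=|\{i\to j\}|-|\{j\to i\}|,\qquad \widetilde r_{ij}=\dim_k\mathrm{Ext}^1(S_i,S_j),\qquad \widetilde I=\begin{bmatrix}I_n\\0\end{bmatrix},$$ and let $\Lambda$ be a skew-symmetric integer $m\times m$ matrix with $\Lambda(-\widetilde B)=\widetilde I$. Write $\Lambda(e,f)=e^{tr}\Lambda f$ and, for $d,e\in\mathbb Z^n$, let $\langle d,e\rangle=\sum_i d_ie_i-\sum_{i,j\le n}d_i\widetilde r_{ij}e_j$ be the Euler form. Let $\mathcal T$ be the $\mathbb Z[q^{\pm1/2}]$-algebra with basis $\{X^e: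 e\in\mathbb Z^m\}$ and multiplication $X^eX^f=q^{\Lambda(e,f)/2}X^{e+f}$. For a $kQ$-module $M$ with dimension vector $\underline m$, let $\mathrm{Gr}_{\underline e}M$ be the set of submodules of $M$ of dimension vector $\underline e$, and for $t\in\mathbb Z^m$ put $$X_{M,t}=\sum_{\underline e}|\mathrm{Gr}_{\underline e}M|\,q^{-\frac12\langle \underline e,\underline m-\underline e\rangle}X^{\widetilde B\underline e-(\widetilde I-\widetilde R)\underline m+t}.$$ The quantum Caldero--Chapoton map on objects of the cluster category of $k\widetilde Q$ is given by $X_{M\oplus P[1]}=X_{M,\underline{\dim}(P/\mathrm{rad}P)}$ for $P$ projective and $X_{M\oplus I[-1]}=X_{M,\underline{\dim}\,\mathrm{soc}I}$ for $I$ injective; in particular $X_{\tau P}=X_{P[1]}=X^{\underline{\dim}(P/\mathrm{rad}P)}$. Write $[U,W]=\dim_k\mathrm{Hom}_{k\widetilde Q}(U,W)$. Let $M$ be a $kQ$-module and $P$ a projective $k\widetilde Q$-module with $[P,M]=[M,I]=1$, where $I=\nu(P)=\mathrm{Hom}_k(\mathrm{Hom}_{k\widetilde Q}(P,k\widetilde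 Q),k)$. Let $f:P\to M$ and $g:M\to I$ be nonzero homomorphisms, and put $$P'=\ker f,\qquad A=\mathrm{coker}\,f,\qquad B=\ker g,\qquad I'=\mathrm{coker}\,g,\qquad E=B\oplus I'[-1],\qquad E'=A\oplus P'[1].$$ Assume that $[B,I']=[P',A]=0$. Then $P'$ is projective, $I'$ is injective, and $$X_{\tau P}X_M=q^{\frac12\Lambda(\underline{\dim}(P/\mathrm{rad}P),\,-(\widetilde I-\widetilde R)\underline m)}X_E+q^{\frac12\Lambda(\underline{\dim}(P/\mathrm{rad}P),\,-(\widetilde I-\widetilde R)\underline m)-\frac12}X_{E'}.$$ -/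

import Mathlib

open Matrix

noncomputable section

/-! ### Quantum tori -/

set_option linter.unusedSectionVars false

section Torus

variable {V : Type*} [Fintype V]

/-- The bilinear form `Λ(e, f) = eᵗ Λ f` on `ℤ^V` attached to an integer matrix `Λ`. -/
def latticeForm (Λ : Matrix V V ℤ) (e f : V → ℤ) : ℤ := e ⬝ᵥ (Λ *ᵥ f)

/-- The based quantum torus over a commutative ring `R`, for a unit `v` (playing the role of
`q^{1/2}`) and an integer matrix `Λ`: the free `R`-module with basis `X^e`, `e ∈ ℤ^V`, with the
multiplication `X^e X^f = v^{Λ(e,f)} X^{e+f}`. -/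
def QuantumTorus {R : Type*} [CommRing R] (_v : Rˣ) (_Λ : Matrix V V ℤ) : Type _ :=
  (V → ℤ) →₀ R

namespace QuantumTorus

variable {R : Type*} [CommRing R] (v : Rˣ) (Λ : Matrix V V ℤ)

instance : AddCommGroup (QuantumTorus v Λ) := inferInstanceAs (AddCommGroup ((V → ℤ) →₀ R))
instance : Module R (QuantumTorus v Λ) := inferInstanceAs (Module R ((V → ℤ) →₀ R))

/-- The monomials `X^e` form a basis of the quantum torus. -/
def basis : Module.Basis (V → ℤ) R (QuantumTorus v Λ) :=
  Module.Basis.ofRepr (LinearEquiv.refl R ((V → ℤ) →₀ R))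

/-- The monomial `X^e`. -/
def X (e : V → ℤ) : QuantumTorus v Λ := basis v Λ e

/-- The bilinear multiplication of the quantum torus. -/
def mulHom : QuantumTorus v Λ →ₗ[R] QuantumTorus v Λ →ₗ[R] QuantumTorus v Λ :=
  (basis v Λ).constr R fun e => (basis v Λ).constr R fun f =>
    ((v ^ latticeForm Λ e f : Rˣ) : R) • X v Λ (e + f)

instance : Mul (QuantumTorus v Λ) := ⟨fun a b => mulHom v Λ a b⟩
instance : One (QuantumTorus v Λ) := ⟨X v Λ 0⟩

theorem X_mul_X (e f : V → ℤ) :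
    X v Λ e * X v Λ f = ((v ^ latticeForm Λ e f : Rˣ) : R) • X v Λ (e + f) := by
  change mulHom v Λ (basis v Λ e) (basis v Λ f) = _
  simp [mulHom, Module.Basis.constr_basis]

theorem hom_ext {V : Type*} [Fintype V] (v : Rˣ) (Λ : Matrix V V ℤ)
    {W : Type*} [AddCommGroup W] [Module R W] {φ ψ : QuantumTorus v Λ →ₗ[R] W}
    (h : ∀ e, φ (X v Λ e) = ψ (X v Λ e)) : φ = ψ :=
  (basis v Λ).ext h

theorem mul_def' (a b : QuantumTorus v Λ) : a * b = mulHom v Λ a b := rfl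

theorem smul_mul' (r : R) (a b : QuantumTorus v Λ) : r • a * b = r • (a * b) := by
  simp [mul_def']

theorem mul_smul' (r : R) (a b : QuantumTorus v Λ) : a * r • b = r • (a * b) := by
  simp [mul_def']

theorem mul_assoc' (a b c : QuantumTorus v Λ) : a * b * c = a * (b * c) := by
  have h : (LinearMap.llcomp R _ _ _ (mulHom v Λ)) ∘ₗ mulHom v Λ =
      (LinearMap.llcomp R _ _ _).flip (mulHom v Λ) ∘ₗ
        (LinearMap.llcomp R _ _ _) ∘ₗ mulHom v Λ := by
    refine hom_ext v Λ fun e => hom_ext v Λ fun f => hom_ext v Λ fun g => ?_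
    change X v Λ e * X v Λ f * X v Λ g = X v Λ e * (X v Λ f * X v Λ g)
    simp only [X_mul_X, smul_mul', mul_smul', smul_smul, ← Units.val_mul, ← _root_.zpow_add, add_assoc]
    congr 3
    simp only [latticeForm, Matrix.mulVec_add, add_dotProduct, dotProduct_add]
    ring
  exact LinearMap.congr_fun (LinearMap.congr_fun (LinearMap.congr_fun h a) b) c

theorem one_mul' (a : QuantumTorus v Λ) : 1 * a = a := by
  have h : mulHom v Λ 1 = LinearMap.id := by
    refine hom_ext v Λ fun e => ?_
    change X v Λ 0 * X v Λ e = X v Λ e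
    simp [X_mul_X, latticeForm]
  exact LinearMap.congr_fun h a

theorem mul_one' (a : QuantumTorus v Λ) : a * 1 = a := by
  have h : (mulHom v Λ).flip 1 = LinearMap.id := by
    refine hom_ext v Λ fun e => ?_
    change X v Λ e * X v Λ 0 = X v Λ e
    simp [X_mul_X, latticeForm]
  exact LinearMap.congr_fun h a

instance : Ring (QuantumTorus v Λ) :=
  { (inferInstance : AddCommGroup (QuantumTorus v Λ)) with
    mul := (· * ·)
    one := 1
    mul_assoc := mul_assoc' v Λ
    one_mul := one_mul' v Λ
    mul_one := mul_one' v Λ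
    left_distrib := fun a b c => map_add (mulHom v Λ a) b c
    right_distrib := fun a b c => by simp [mul_def']
    zero_mul := fun a => by simp [mul_def']
    mul_zero := fun a => map_zero (mulHom v Λ a) }

instance : Algebra R (QuantumTorus v Λ) :=
  Algebra.ofModule (smul_mul' v Λ) (fun r a b => mul_smul' v Λ r a b)

end QuantumTorus

/-- The ring `ℤ[|k|^{±1/2}]`, as a subring of `ℝ`. -/
abbrev HalfPowerRing (k : Type*) : Subalgebra ℤ ℝ :=
  Algebra.adjoin ℤ {√(Nat.card k : ℝ), (√(Nat.card k : ℝ))⁻¹}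

/-- The unit `q^{1/2}` of `ℤ[q^{±1/2}]`, for `q = |k|`. -/
def qHalf (k : Type*) [Nonempty k] [Finite k] : (HalfPowerRing k)ˣ where
  val := ⟨√(Nat.card k : ℝ), Algebra.subset_adjoin (by simp)⟩
  inv := ⟨(√(Nat.card k : ℝ))⁻¹, Algebra.subset_adjoin (by simp)⟩
  val_inv := Subtype.ext (mul_inv_cancel₀
    (Real.sqrt_ne_zero'.2 (Nat.cast_pos.2 Nat.card_pos)))
  inv_val := Subtype.ext (inv_mul_cancel₀
    (Real.sqrt_ne_zero'.2 (Nat.cast_pos.2 Nat.card_pos)))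

end Torus

/-! ### Path algebras -/

section PathAlgebra

/-- A quiver is acyclic if it has no oriented cycle of positive length. -/
def IsAcyclicQuiver (V : Type*) [Quiver V] : Prop :=
  ∀ (i : V) (p : Quiver.Path i i), p.length = 0

/-- The path algebra `k V` of a quiver: the free `k`-module on all paths. The product `p q` is the
path `p` followed by the path `q` if `q` starts where `p` ends, and `0` otherwise. In particular an
arrow `a : i ⟶ j` satisfies `a = e_i a e_j`, so it acts on a left module `M` as a map
`e_j M → e_i M`. -/
def PathAlgebra (k V : Type*) [Field k] [Quiver V] : Type _ :=
  (Σ i j : V, Quiver.Path i j) →₀ k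

namespace PathAlgebra

variable (k V : Type*) [Field k] [Quiver V]

instance : AddCommGroup (PathAlgebra k V) :=
  inferInstanceAs (AddCommGroup ((Σ i j : V, Quiver.Path i j) →₀ k))
instance : Module k (PathAlgebra k V) :=
  inferInstanceAs (Module k ((Σ i j : V, Quiver.Path i j) →₀ k))

variable {V}

/-- The paths form a basis of the path algebra. -/
def basis : Module.Basis (Σ i j : V, Quiver.Path i j) k (PathAlgebra k V) :=
  Module.Basis.ofRepr (LinearEquiv.refl k ((Σ i j : V, Quiver.Path i j) →₀ k))

/-- The basis element of the path algebra given by a path. -/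
def ofPath {i j : V} (p : Quiver.Path i j) : PathAlgebra k V := basis k ⟨i, j, p⟩

variable [DecidableEq V]

/-- The product of two paths in the path algebra. -/
def pathMul {i j i' j' : V} (p : Quiver.Path i j) (q : Quiver.Path i' j') : PathAlgebra k V :=
  if h : i' = j then ofPath k (p.comp (h ▸ q)) else 0

variable (V)

/-- The bilinear multiplication of the path algebra. -/
def mulHom : PathAlgebra k V →ₗ[k] PathAlgebra k V →ₗ[k] PathAlgebra k V :=
  (basis k).constr k fun p => (basis k).constr k fun q => pathMul k p.2.2 q.2.2

instance : Mul (PathAlgebra k V) := ⟨fun a b => mulHom k V a b⟩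

/-- The trivial path `e_i`. -/
def idem {V : Type*} [Quiver V] (i : V) : PathAlgebra k V := ofPath k (Quiver.Path.nil : Quiver.Path i i)

theorem mul_def' (a b : PathAlgebra k V) : a * b = mulHom k V a b := rfl

theorem ofPath_mul {i j i' j' : V} (p : Quiver.Path i j) (q : Quiver.Path i' j') :
    ofPath k p * ofPath k q = pathMul k p q := by
  change mulHom k V (basis k ⟨i, j, p⟩) (basis k ⟨i', j', q⟩) = _
  simp [mulHom, Module.Basis.constr_basis]

theorem ofPath_mul_comp {i j l : V} (p : Quiver.Path i j) (q : Quiver.Path j l) :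
    ofPath k p * ofPath k q = ofPath k (p.comp q) := by
  simp [ofPath_mul, pathMul]

theorem ofPath_mul_ne {i j i' j' : V} (p : Quiver.Path i j) (q : Quiver.Path i' j') (h : i' ≠ j) :
    ofPath k p * ofPath k q = 0 := by
  simp [ofPath_mul, pathMul, h]

theorem hom_ext {V : Type*} [Quiver V] {W : Type*} [AddCommGroup W] [Module k W]
    {φ ψ : PathAlgebra k V →ₗ[k] W}
    (h : ∀ (i j : V) (p : Quiver.Path i j), φ (ofPath k p) = ψ (ofPath k p)) : φ = ψ :=
  (basis k).ext fun e => h e.1 e.2.1 e.2.2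

theorem smul_mul' (r : k) (a b : PathAlgebra k V) : r • a * b = r • (a * b) := by
  simp [mul_def']

theorem mul_smul' (r : k) (a b : PathAlgebra k V) : a * r • b = r • (a * b) := by
  simp [mul_def']

theorem zero_mul' (a : PathAlgebra k V) : 0 * a = 0 := by simp [mul_def']

theorem mul_zero' (a : PathAlgebra k V) : a * 0 = 0 := map_zero (mulHom k V a)

theorem mul_assoc' (a b c : PathAlgebra k V) : a * b * c = a * (b * c) := by
  have h : (LinearMap.llcomp k _ _ _ (mulHom k V)) ∘ₗ mulHom k V =
      (LinearMap.llcomp k _ _ _).flip (mulHom k V) ∘ₗ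
        (LinearMap.llcomp k _ _ _) ∘ₗ mulHom k V := by
    refine hom_ext k fun i j p => hom_ext k fun i' j' q => hom_ext k fun i'' j'' r => ?_
    change ofPath k p * ofPath k q * ofPath k r = ofPath k p * (ofPath k q * ofPath k r)
    by_cases h₁ : i' = j
    · subst h₁
      by_cases h₂ : i'' = j'
      · subst h₂
        simp only [ofPath_mul_comp, Quiver.Path.comp_assoc]
      · rw [ofPath_mul_comp, ofPath_mul_ne k V _ r h₂, ofPath_mul_ne k V q r h₂, mul_zero']
    · rw [ofPath_mul_ne k V p q h₁, zero_mul']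
      by_cases h₂ : i'' = j'
      · subst h₂
        rw [ofPath_mul_comp, ofPath_mul_ne k V p _ h₁]
      · rw [ofPath_mul_ne k V q r h₂, mul_zero']
  exact LinearMap.congr_fun (LinearMap.congr_fun (LinearMap.congr_fun h a) b) c

variable [Fintype V]

instance : One (PathAlgebra k V) := ⟨∑ i : V, idem k i⟩

theorem one_mul' (a : PathAlgebra k V) : 1 * a = a := by
  have h : mulHom k V 1 = LinearMap.id := by
    refine hom_ext k fun i j p => ?_
    change mulHom k V (∑ l : V, idem k l) (ofPath k p) = ofPath k p
    rw [map_sum, LinearMap.sum_apply, Finset.sum_eq_single i]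
    · exact (ofPath_mul_comp k V _ p).trans (by simp)
    · exact fun l _ hl => ofPath_mul_ne k V _ p (Ne.symm hl)
    · simp
  exact LinearMap.congr_fun h a

theorem mul_one' (a : PathAlgebra k V) : a * 1 = a := by
  have h : (mulHom k V).flip 1 = LinearMap.id := by
    refine hom_ext k fun i j p => ?_
    change mulHom k V (ofPath k p) (∑ l : V, idem k l) = ofPath k p
    rw [map_sum, Finset.sum_eq_single j]
    · exact (ofPath_mul_comp k V p _).trans (by simp)
    · exact fun l _ hl => ofPath_mul_ne k V p _ hl
    · simp
  exact LinearMap.congr_fun h a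

instance : Ring (PathAlgebra k V) :=
  { (inferInstance : AddCommGroup (PathAlgebra k V)) with
    mul := (· * ·)
    one := 1
    mul_assoc := mul_assoc' k V
    one_mul := one_mul' k V
    mul_one := mul_one' k V
    left_distrib := fun a b c => map_add (mulHom k V a) b c
    right_distrib := fun a b c => by simp [mul_def']
    zero_mul := zero_mul' k V
    mul_zero := mul_zero' k V }

instance : Algebra k (PathAlgebra k V) :=
  Algebra.ofModule (smul_mul' k V) (fun r a b => mul_smul' k V r a b)

end PathAlgebra

end PathAlgebra

/-! ### Modules over a finite-dimensional algebra -/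

section Modules

variable (k A : Type*) [Field k] [Ring A] [Algebra k A]

/-- `[M, N] = dim_k Hom_A(M, N)`. -/
def homDim (M N : Type*) [AddCommGroup M] [Module A M]
    [AddCommGroup N] [Module k N] [Module A N] [IsScalarTower k A N] : ℕ :=
  Module.finrank k (M →ₗ[A] N)

/-- The socle of a module: the sum of all its simple submodules. -/
def moduleSocle (M : Type*) [AddCommGroup M] [Module A M] : Submodule A M :=
  sSup {S : Submodule A M | IsSimpleModule A S}

/-- The Nakayama functor on objects, `ν(P) = D Hom_A(P, A)` with `D = Hom_k(-, k)`. -/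
def Nakayama (P : Type*) [AddCommGroup P] [Module A P] : Type _ :=
  Module.Dual k (P →ₗ[A] A)

namespace Nakayama

variable (P : Type*) [AddCommGroup P] [Module A P]

instance : AddCommGroup (Nakayama k A P) := inferInstanceAs (AddCommGroup (Module.Dual k (P →ₗ[A] A)))
instance : Module k (Nakayama k A P) := inferInstanceAs (Module k (Module.Dual k (P →ₗ[A] A)))

/-- The right action of `a ∈ A` on `Hom_A(P, A)`: `(φ a)(p) = φ(p) a`. -/
def rightMul (a : A) : (P →ₗ[A] A) →ₗ[k] (P →ₗ[A] A) where
  toFun φ := LinearMap.toSpanSingleton A A a ∘ₗ φ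
  map_add' φ ψ := by ext; simp [add_mul]
  map_smul' r φ := by ext; simp

/-- The left action of `A` on `ν(P)`: `(a ξ)(φ) = ξ(φ a)`. -/
instance : Module A (Nakayama k A P) where
  smul a ξ := LinearMap.comp (show Module.Dual k (P →ₗ[A] A) from ξ) (rightMul k A P a)
  one_smul ξ := by
    refine LinearMap.ext fun φ => congrArg (show Module.Dual k (P →ₗ[A] A) from ξ) ?_
    ext; simp [rightMul]
  mul_smul a b ξ := by
    refine LinearMap.ext fun φ => congrArg (show Module.Dual k (P →ₗ[A] A) from ξ) ?_
    ext; simp [rightMul, mul_assoc]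
  smul_zero a := LinearMap.zero_comp _
  smul_add a ξ η := LinearMap.add_comp _ _ _
  add_smul a b ξ := by
    refine LinearMap.ext fun φ => (congrArg (show Module.Dual k (P →ₗ[A] A) from ξ) ?_).trans
      (map_add (show Module.Dual k (P →ₗ[A] A) from ξ) _ _)
    ext; simp [rightMul, mul_add]
  zero_smul ξ := by
    refine LinearMap.ext fun φ => (congrArg (show Module.Dual k (P →ₗ[A] A) from ξ) ?_).trans
      (map_zero (show Module.Dual k (P →ₗ[A] A) from ξ))
    ext; simp [rightMul]

theorem smul_apply' (a : A) (ξ : Nakayama k A P) (φ : P →ₗ[A] A) :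
    (show Module.Dual k (P →ₗ[A] A) from a • ξ) φ =
      (show Module.Dual k (P →ₗ[A] A) from ξ) (rightMul k A P a φ) := rfl

instance : IsScalarTower k A (Nakayama k A P) where
  smul_assoc r a ξ := by
    refine LinearMap.ext fun φ => (congrArg (show Module.Dual k (P →ₗ[A] A) from ξ) ?_).trans
      (map_smul (show Module.Dual k (P →ₗ[A] A) from ξ) r (rightMul k A P a φ))
    ext; simp [rightMul]

end Nakayama

end Modules

/-! ### Ice quivers and the quantum Caldero-Chapoton map -/

section IceQuiver

/- The vertex set of the ice quiver is `V`. The finite set `N` consists of the vertices of the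
principal part (the full subquiver on `N`), and the vertices outside `N` are frozen. -/
variable {V : Type*} [Fintype V] [DecidableEq V] [Quiver V] [∀ i j : V, Fintype (i ⟶ j)]
  (N : Finset V)

/-- The number of arrows `i ⟶ j`. -/
def arrowCount (i j : V) : ℤ := (Fintype.card (i ⟶ j) : ℤ)

/-- The matrix of an ice quiver: `b_{ij}` is the number of arrows `i ⟶ j` minus the number of
arrows `j ⟶ i`, for `i` a vertex and `j` in the principal part. -/
def matB : Matrix V N ℤ := Matrix.of fun i j => arrowCount i (j : V) - arrowCount (j : V) i

/-- The left part of the identity matrix, with columns indexed by the principal part. -/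
def matI : Matrix V N ℤ := Matrix.of fun i j => if i = (j : V) then 1 else 0

/-- `r_{ij} = dim Ext¹(S_i, S_j)`, which is the number of arrows `j ⟶ i`. -/
def matR : Matrix V N ℤ := Matrix.of fun i j => arrowCount (j : V) i

/-- The Euler form of the principal part,
`⟨d, e⟩ = ∑ d_i e_i - ∑ d_i dim Ext¹(S_i, S_j) e_j`. -/
def eulerForm (d e : N → ℤ) : ℤ :=
  ∑ i, d i * e i - ∑ i : N, ∑ j : N, d i * matR N (i : V) j * e j

variable (k : Type*) [Field k]

/-- The dimension vector of a module over the path algebra: `i ↦ dim_k e_i M`. -/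
def dimVec (M : Type*) [AddCommGroup M] [Module k M] [Module (PathAlgebra k V) M]
    [IsScalarTower k (PathAlgebra k V) M] (i : V) : ℕ :=
  Module.finrank k (LinearMap.range (Algebra.lsmul k k M (PathAlgebra.idem k i)))

/-- A module over the path algebra of the ice quiver is a module over the path algebra of its
principal part if the trivial paths at the frozen vertices act by zero. -/
def IsPrincipalModule (M : Type*) [AddCommGroup M] [Module (PathAlgebra k V) M] : Prop :=
  ∀ i : V, i ∉ N → ∀ x : M, PathAlgebra.idem k i • x = 0

/-- The restriction of the dimension vector to the vertices of the principal part. -/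
def principalDim (M : Type*) [AddCommGroup M] [Module k M] [Module (PathAlgebra k V) M]
    [IsScalarTower k (PathAlgebra k V) M] (i : N) : ℕ := dimVec k M (i : V)

/-- The quiver Grassmannian of submodules of dimension vector `e`, for a module `M` over the path
algebra of the principal part. -/
def QuiverGrassmannian (M : Type*) [AddCommGroup M] [Module k M] [Module (PathAlgebra k V) M]
    [IsScalarTower k (PathAlgebra k V) M] (e : N → ℕ) : Type _ :=
  {U : Submodule (PathAlgebra k V) M // principalDim N k U = e}

/-- The dimension vector of `P / rad P`. -/
def topVec (P : Type*) [AddCommGroup P] [Module k P] [Module (PathAlgebra k V) P]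
    [IsScalarTower k (PathAlgebra k V) P] (i : V) : ℤ :=
  (dimVec k (P ⧸ Module.jacobson (PathAlgebra k V) P) i : ℤ)

/-- The dimension vector of `soc I`. -/
def socVec (I : Type*) [AddCommGroup I] [Module k I] [Module (PathAlgebra k V) I]
    [IsScalarTower k (PathAlgebra k V) I] (i : V) : ℤ :=
  (dimVec k (moduleSocle (PathAlgebra k V) I) i : ℤ)

/-- The vector `(Ĩ - R̃) m`, where `m` is the dimension vector of `M`. -/
def coindexVec (M : Type*) [AddCommGroup M] [Module k M] [Module (PathAlgebra k V) M]
    [IsScalarTower k (PathAlgebra k V) M] : V → ℤ :=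
  (matI N - matR N) *ᵥ fun i => (principalDim N k M i : ℤ)

variable [Finite k] (Λ : Matrix V V ℤ)

/-- The based quantum torus over `ℤ[|k|^{±1/2}]` attached to `Λ`. -/
abbrev Torus : Type _ := QuantumTorus (qHalf k) Λ

/-- The power `q^{z/2}`, an element of `ℤ[q^{±1/2}]`, for `q = |k|`. -/
def qHalfPow (z : ℤ) : HalfPowerRing k := ((qHalf k ^ z : (HalfPowerRing k)ˣ) : HalfPowerRing k)

/-- The sum `∑_e |Gr_e M| q^{-⟨e, m - e⟩/2} X^{B̃ e - (Ĩ - R̃) m + t}`, where `m` is the dimension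
vector of `M`. Only vectors `0 ≤ e ≤ m` are summed over; all other `Gr_e M` are empty. -/
def ccSum (M : Type*) [AddCommGroup M] [Module k M] [Module (PathAlgebra k V) M]
    [IsScalarTower k (PathAlgebra k V) M] (t : V → ℤ) : Torus k Λ :=
  ∑ e ∈ Finset.Icc 0 (principalDim N k M),
    ((Nat.card (QuiverGrassmannian N k M e) : HalfPowerRing k) *
      qHalfPow k (-eulerForm N (fun i => (e i : ℤ))
        (fun i => (principalDim N k M i : ℤ) - (e i : ℤ)))) •
    QuantumTorus.X (qHalf k) Λ
      (matB N *ᵥ (fun i => (e i : ℤ)) - coindexVec N k M + t)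

/-- The value `X_{M ⊕ P[1]}` of the quantum Caldero-Chapoton map at the object `M ⊕ P[1]` of the
cluster category, for a module `M` over the path algebra of the principal part and a projective
module `P` over the path algebra of the ice quiver. -/
def ccShiftProj (M P : Type*) [AddCommGroup M] [Module k M] [Module (PathAlgebra k V) M]
    [IsScalarTower k (PathAlgebra k V) M] [AddCommGroup P] [Module k P]
    [Module (PathAlgebra k V) P] [IsScalarTower k (PathAlgebra k V) P] : Torus k Λ :=
  ccSum N k Λ M (topVec k P)

/-- The value `X_{M ⊕ I[-1]}` of the quantum Caldero-Chapoton map at the object `M ⊕ I[-1]` of the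
cluster category, for an injective module `I`. In the cluster category `I[-1]` is `P[1]` for the
projective module `P` with `I = ν(P)`, for which `P / rad P = soc I`. -/
def ccShiftInj (M I : Type*) [AddCommGroup M] [Module k M] [Module (PathAlgebra k V) M]
    [IsScalarTower k (PathAlgebra k V) M] [AddCommGroup I] [Module k I]
    [Module (PathAlgebra k V) I] [IsScalarTower k (PathAlgebra k V) I] : Torus k Λ :=
  ccSum N k Λ M (socVec k I)

/-- `X_M = X_{M ⊕ 0[1]}`. -/
def ccModule (M : Type*) [AddCommGroup M] [Module k M] [Module (PathAlgebra k V) M]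
    [IsScalarTower k (PathAlgebra k V) M] : Torus k Λ := ccShiftProj N k Λ M PUnit.{1}

/-- `X_{τP} = X_{0 ⊕ P[1]}`: in the cluster category `τP` is `P[1]`. -/
def ccTau (P : Type*) [AddCommGroup P] [Module k P] [Module (PathAlgebra k V) P]
    [IsScalarTower k (PathAlgebra k V) P] : Torus k Λ := ccShiftProj N k Λ PUnit.{1} P

end IceQuiver

end

/-!
The proof compares both sides of the multiplication formula submodule by submodule.

By definition `X_M` is a sum over the submodules `U` of `M`, and multiplying by `X_{τP} = X^t`, with
`t` the dimension vector of `P / rad P`, only multiplies the term of `U` by a power of `q^{1/2}` and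
shifts its exponent by `t`. By compatibility of `Λ` and `B̃`, that power contains the factor
`q^{-½ ∑ t_i u_i}`, where `u` is the dimension vector of `U` and `∑ t_i u_i = [P, U] = [U, ν(P)]`.
As `[P, M] = 1`, this number is `0` or `1`. In the first case `U` lies in `B = ker g`, and in the
second case `U` contains `D = im f` (`not_le_ker_iff_range_le`). So the submodules of `M` are those
of `B` together with those of `A = M / D`, which index the two sums on the right hand side. The
terms agree (`ccTerm_of_le_ker`, `ccTerm_comap_mkQ`) because the Euler characteristics of
`L = im g` and of `D` can be computed from the resolutions `0 → L → ν(P) → I' → 0` and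
`0 → P' → P → D → 0`. They give `(Ĩ - R̃) l = t - soc I'` and `(Ĩ - R̃ - B̃) d = t - top P'` for the
exponents, and together with `[B, I'] = [P', A] = 0` they give `⟨U, L⟩ = 0` and `⟨D, M / U⟩ = 0` for
the powers of `q`.

The homological input is elementary. Modules over the path algebra are representations of the
quiver, and `Hom(X, Y)` and `Ext¹(X, Y)` are the cohomology of a complex with two terms, whose
differential is `standardDiff`. It is surjective if the sum of the arrows leaving each vertex is
injective on `X` (`ArrowsInjective`), or if the product of the arrows entering each vertex is
surjective on `Y` (`ArrowsSurjective`). These conditions imply projectivity and injectivity. The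
first one holds for projective modules and passes to submodules; the second one holds for modules
`ν(P)` and passes to quotients. Hence `P'` is projective and `I'` is injective, and the dimensions
of homomorphism spaces from `P` and `P'`, and to `ν(P)` and `I'`, are determined by the dimension
vectors of tops and socles (`homDim_eq_sum_topVec`, `homDim_eq_sum_socVec`).
-/

open Matrix

set_option linter.unusedSectionVars false

noncomputable section

/-! ### Modules over the path algebra as representations of the quiver -/

section Representation

variable {k V : Type*} [Field k] [Fintype V] [DecidableEq V] [Quiver V]

namespace PathAlgebra

/-- The element of the path algebra given by an arrow. -/
def arrow (k : Type*) [Field k] {i j : V} (a : i ⟶ j) : PathAlgebra k V := ofPath k a.toPath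

theorem idem_mul_ofPath {i j : V} (p : Quiver.Path i j) :
    idem k i * ofPath k p = ofPath k p := by
  rw [idem, ofPath_mul_comp, Quiver.Path.nil_comp]

theorem ofPath_mul_idem {i j : V} (p : Quiver.Path i j) :
    ofPath k p * idem k j = ofPath k p := by
  rw [idem, ofPath_mul_comp, Quiver.Path.comp_nil]

theorem ofPath_mul_idem_ne {i j l : V} (p : Quiver.Path i j) (h : l ≠ j) :
    ofPath k p * idem k l = 0 := ofPath_mul_ne k V _ _ h

theorem idem_mul_idem (i : V) : idem k i * idem k i = idem k i := idem_mul_ofPath _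

theorem idem_mul_idem_ne {i j : V} (h : i ≠ j) : idem k i * idem k j = 0 :=
  ofPath_mul_ne k V _ _ h.symm

theorem idem_mul_arrow {i j : V} (a : i ⟶ j) : idem k i * arrow k a = arrow k a :=
  idem_mul_ofPath _

theorem arrow_mul_idem {i j : V} (a : i ⟶ j) : arrow k a * idem k j = arrow k a :=
  ofPath_mul_idem _

theorem ofPath_cons {i j l : V} (p : Quiver.Path i j) (a : j ⟶ l) :
    ofPath k (p.cons a) = ofPath k p * arrow k a := by
  rw [arrow, ofPath_mul_comp]; rfl

theorem sum_idem : ∑ i : V, idem k i = 1 := rfl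

end PathAlgebra

open PathAlgebra

section

variable (k) (X : Type*) [AddCommGroup X] [Module k X] [Module (PathAlgebra k V) X]
  [IsScalarTower k (PathAlgebra k V) X]

/-- The component `e_i X` of a module `X` at the vertex `i`. -/
def vertexSpace (i : V) : Submodule k X :=
  LinearMap.range (Algebra.lsmul k k X (PathAlgebra.idem k i))

theorem dimVec_eq (i : V) : dimVec k X i = Module.finrank k (vertexSpace k X i) := rfl

/-- The projection `x ↦ e_i x` onto the component at the vertex `i`. -/
def vertexProj (i : V) : X →ₗ[k] vertexSpace k X i :=
  (Algebra.lsmul k k X (PathAlgebra.idem k i)).rangeRestrict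

variable {k X}

@[simp] theorem coe_vertexProj (i : V) (x : X) : (vertexProj k X i x : X) = idem k i • x := rfl

theorem mem_vertexSpace {i : V} {x : X} : x ∈ vertexSpace k X i ↔ idem k i • x = x := by
  constructor
  · rintro ⟨y, rfl⟩
    simp [← mul_smul, idem_mul_idem]
  · intro h
    exact ⟨x, h⟩

theorem idem_smul_coe {i : V} (x : vertexSpace k X i) : idem k i • (x : X) = x :=
  mem_vertexSpace.1 x.2

theorem idem_smul_mem (i : V) (x : X) : idem k i • x ∈ vertexSpace k X i := ⟨x, rfl⟩

theorem idem_smul_coe_ne {i j : V} (h : i ≠ j) (x : vertexSpace k X j) :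
    idem k i • (x : X) = 0 := by
  rw [← idem_smul_coe x, ← mul_smul, idem_mul_idem_ne h, zero_smul]

theorem sum_idem_smul (x : X) : ∑ i : V, idem k i • x = x := by
  rw [← Finset.sum_smul, sum_idem, one_smul]

theorem vertexProj_coe {i : V} (x : vertexSpace k X i) : vertexProj k X i x = x :=
  Subtype.ext (idem_smul_coe x)

theorem arrow_smul_mem {i j : V} (a : i ⟶ j) (x : X) : arrow k a • x ∈ vertexSpace k X i := by
  rw [mem_vertexSpace, ← mul_smul, idem_mul_arrow]

theorem arrow_smul_idem_smul {i j : V} (a : i ⟶ j) (x : X) :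
    arrow k a • idem k j • x = arrow k a • x := by
  rw [← mul_smul, arrow_mul_idem]

variable (k X) in
/-- The map `e_j X → e_i X` by which an arrow `i ⟶ j` acts. -/
def arrowMap {i j : V} (a : i ⟶ j) : vertexSpace k X j →ₗ[k] vertexSpace k X i :=
  (Algebra.lsmul k k X (arrow k a)).restrict fun x _ => arrow_smul_mem a x

@[simp] theorem coe_arrowMap {i j : V} (a : i ⟶ j) (x : vertexSpace k X j) :
    (arrowMap k X a x : X) = arrow k a • (x : X) := rfl

/-- A `k`-linear map which commutes with the trivial paths and the arrows is linear over the path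
algebra. -/
theorem map_smul_of_map_arrow {Y : Type*} [AddCommGroup Y] [Module k Y]
    [Module (PathAlgebra k V) Y] [IsScalarTower k (PathAlgebra k V) Y] (h : X →ₗ[k] Y)
    (hi : ∀ (i : V) x, h (idem k i • x) = idem k i • h x)
    (ha : ∀ (i j : V) (a : i ⟶ j) x, h (arrow k a • x) = arrow k a • h x)
    (r : PathAlgebra k V) (x : X) : h (r • x) = r • h x := by
  have hp : ∀ (i j : V) (p : Quiver.Path i j) (x : X), h (ofPath k p • x) = ofPath k p • h x := by
    intro i j p
    induction p with
    | nil => exact hi i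
    | cons p a ih => intro x; rw [ofPath_cons, mul_smul, ih, ha, mul_smul]
  have key : h ∘ₗ (LinearMap.toSpanSingleton (PathAlgebra k V) X x).restrictScalars k =
      (LinearMap.toSpanSingleton (PathAlgebra k V) Y (h x)).restrictScalars k :=
    PathAlgebra.hom_ext k fun i j p => by simpa using hp i j p x
  simpa using LinearMap.congr_fun key r

/-- A `k`-subspace of a module is a submodule if it is stable under trivial paths and arrows. -/
theorem smul_mem_of_arrow_smul_mem (S : Submodule k X)
    (hi : ∀ (i : V), ∀ x ∈ S, idem k i • x ∈ S)
    (ha : ∀ (i j : V) (a : i ⟶ j), ∀ x ∈ S, arrow k a • x ∈ S)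
    (r : PathAlgebra k V) {x : X} (hx : x ∈ S) : r • x ∈ S := by
  have hp : ∀ (i j : V) (p : Quiver.Path i j), ∀ x ∈ S, ofPath k p • x ∈ S := by
    intro i j p
    induction p with
    | nil => exact hi i
    | cons p a ih => intro x hx; rw [ofPath_cons, mul_smul]; exact ih _ (ha _ _ a x hx)
  have key : S.mkQ ∘ₗ (LinearMap.toSpanSingleton (PathAlgebra k V) X x).restrictScalars k = 0 :=
    PathAlgebra.hom_ext k fun i j p => by simpa using hp i j p x hx
  simpa using LinearMap.congr_fun key r

end

section Hom

variable {X Y Z : Type*} [AddCommGroup X] [Module k X] [Module (PathAlgebra k V) X]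
  [IsScalarTower k (PathAlgebra k V) X] [AddCommGroup Y] [Module k Y]
  [Module (PathAlgebra k V) Y] [IsScalarTower k (PathAlgebra k V) Y]
  [AddCommGroup Z] [Module k Z] [Module (PathAlgebra k V) Z] [IsScalarTower k (PathAlgebra k V) Z]

/-- The map induced on components by a homomorphism of modules. -/
def vertexMap (φ : X →ₗ[PathAlgebra k V] Y) (i : V) : vertexSpace k X i →ₗ[k] vertexSpace k Y i :=
  (φ.restrictScalars k).restrict fun x hx => by
    rw [mem_vertexSpace] at hx ⊢
    rw [LinearMap.restrictScalars_apply, ← map_smul, hx]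

@[simp] theorem coe_vertexMap (φ : X →ₗ[PathAlgebra k V] Y) (i : V) (x : vertexSpace k X i) :
    (vertexMap φ i x : Y) = φ x := rfl

theorem vertexMap_arrowMap (φ : X →ₗ[PathAlgebra k V] Y) {i j : V} (a : i ⟶ j)
    (x : vertexSpace k X j) :
    vertexMap φ i (arrowMap k X a x) = arrowMap k Y a (vertexMap φ j x) :=
  Subtype.ext (by simp)

theorem vertexMap_injective {φ : X →ₗ[PathAlgebra k V] Y} (hφ : Function.Injective φ) (i : V) :
    Function.Injective (vertexMap φ i) := fun x y h =>
  Subtype.ext (hφ (by simpa using congrArg Subtype.val h))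

theorem vertexMap_surjective {φ : X →ₗ[PathAlgebra k V] Y} (hφ : Function.Surjective φ) (i : V) :
    Function.Surjective (vertexMap φ i) := fun y => by
  obtain ⟨x, hx⟩ := hφ y
  exact ⟨vertexProj k X i x, Subtype.ext (by simp [hx, idem_smul_coe])⟩

/-- Dimension vectors are additive in short exact sequences. -/
theorem dimVec_add_of_exact [Module.Finite k Y] {φ : X →ₗ[PathAlgebra k V] Y}
    {ψ : Y →ₗ[PathAlgebra k V] Z} (hφ : Function.Injective φ) (hψ : Function.Surjective ψ)
    (h : Function.Exact φ ψ) (i : V) :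
    dimVec k Y i = dimVec k X i + dimVec k Z i := by
  have h1 := (vertexMap ψ i).finrank_range_add_finrank_ker
  rw [LinearMap.range_eq_top.2 (vertexMap_surjective hψ i), finrank_top] at h1
  have h2 : LinearMap.ker (vertexMap ψ i) = LinearMap.range (vertexMap φ i) := by
    ext y
    constructor
    · intro hy
      obtain ⟨x, hx⟩ := (h y).1 (by simpa using congrArg Subtype.val hy)
      exact ⟨vertexProj k X i x, Subtype.ext (by simp [hx, idem_smul_coe])⟩
    · rintro ⟨x, rfl⟩
      exact Subtype.ext (by simpa using h.apply_apply_eq_zero (x : X))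
  rw [h2, LinearMap.finrank_range_of_inj (vertexMap_injective hφ i)] at h1
  simp only [dimVec_eq]
  lia

theorem dimVec_submodule_add [Module.Finite k Y] (U : Submodule (PathAlgebra k V) Y) (i : V) :
    dimVec k Y i = dimVec k U i + dimVec k (Y ⧸ U) i :=
  dimVec_add_of_exact (φ := U.subtype) (ψ := U.mkQ) U.subtype_injective U.mkQ_surjective
    (LinearMap.exact_subtype_mkQ U) i

theorem dimVec_ker_add_range [Module.Finite k X] (φ : X →ₗ[PathAlgebra k V] Y) (i : V) :
    dimVec k X i = dimVec k (LinearMap.ker φ) i + dimVec k (LinearMap.range φ) i :=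
  dimVec_add_of_exact (φ := (LinearMap.ker φ).subtype) (ψ := φ.rangeRestrict)
    (Submodule.subtype_injective _) φ.surjective_rangeRestrict
    (fun x => by simp [Subtype.ext_iff]) i

theorem dimVec_le_of_injective [Module.Finite k Y] {φ : X →ₗ[PathAlgebra k V] Y}
    (hφ : Function.Injective φ) (i : V) : dimVec k X i ≤ dimVec k Y i :=
  LinearMap.finrank_le_finrank_of_injective (vertexMap_injective hφ i)

theorem dimVec_congr (e : X ≃ₗ[PathAlgebra k V] Y) (i : V) : dimVec k X i = dimVec k Y i :=
  (LinearEquiv.ofBijective (vertexMap e.toLinearMap i)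
    ⟨vertexMap_injective e.injective i, vertexMap_surjective e.surjective i⟩).finrank_eq

theorem dimVec_eq_zero_of_subsingleton [Subsingleton X] (i : V) : dimVec k X i = 0 := by
  rw [dimVec_eq]; exact Module.finrank_zero_of_subsingleton

/-- A family of linear maps on the components which is compatible with the arrows glues to a
homomorphism of modules. -/
theorem exists_hom_of_family (h : ∀ i : V, vertexSpace k X i →ₗ[k] vertexSpace k Y i)
    (hc : ∀ (i j : V) (a : i ⟶ j) x, h i (arrowMap k X a x) = arrowMap k Y a (h j x)) :
    ∃ φ : X →ₗ[PathAlgebra k V] Y, ∀ i, vertexMap φ i = h i := by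
  let H : X →ₗ[k] Y := ∑ i : V, (vertexSpace k Y i).subtype ∘ₗ h i ∘ₗ vertexProj k X i
  have hH : ∀ x, H x = ∑ i : V, (h i (vertexProj k X i x) : Y) := fun x => by simp [H]
  have hHi : ∀ (i : V) (x : vertexSpace k X i), H x = h i x := by
    intro i x
    rw [hH, Finset.sum_eq_single i, vertexProj_coe]
    · intro j _ hj
      have : vertexProj k X j (x : X) = 0 := Subtype.ext (by simp [idem_smul_coe_ne hj])
      simp [this]
    · simp
  have hidem : ∀ (i : V) x, H (idem k i • x) = idem k i • H x := by
    intro i x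
    rw [show idem k i • x = (vertexProj k X i x : X) from rfl, hHi, hH x, Finset.smul_sum,
      Finset.sum_eq_single i]
    · rw [idem_smul_coe]
    · intro j _ hj
      exact idem_smul_coe_ne hj.symm _
    · simp
  have harr : ∀ (i j : V) (a : i ⟶ j) x, H (arrow k a • x) = arrow k a • H x := by
    intro i j a x
    have : arrow k a • x = (arrowMap k X a (vertexProj k X j x) : X) := by
      simp [arrow_smul_idem_smul]
    rw [this, hHi, hc, coe_arrowMap, ← hHi, coe_vertexProj, hidem, arrow_smul_idem_smul]
  refine ⟨{ toFun := H, map_add' := map_add H,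
            map_smul' := map_smul_of_map_arrow H hidem harr }, fun i => ?_⟩
  ext x
  exact hHi i x

theorem hom_eq_of_vertexMap_eq {φ ψ : X →ₗ[PathAlgebra k V] Y}
    (h : ∀ i, vertexMap φ i = vertexMap ψ i) : φ = ψ := by
  ext x
  rw [← sum_idem_smul (k := k) (V := V) x, map_sum, map_sum]
  refine Finset.sum_congr rfl fun i _ => ?_
  exact congrArg Subtype.val (LinearMap.congr_fun (h i) (vertexProj k X i x))

variable (k V X Y) in
/-- The differential of the standard complex
`∏ᵢ Hom(X_i, Y_i) → ∏_{a : i ⟶ j} Hom(X_j, Y_i)`, whose cohomology is `Hom(X, Y)` and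
`Ext¹(X, Y)`. It sends `h` to the family of all `a h_j - h_i a`. -/
def standardDiff : (∀ i : V, vertexSpace k X i →ₗ[k] vertexSpace k Y i) →ₗ[k]
    (∀ a : Σ i j : V, (i ⟶ j), vertexSpace k X a.2.1 →ₗ[k] vertexSpace k Y a.1) where
  toFun h a := arrowMap k Y a.2.2 ∘ₗ h a.2.1 - h a.1 ∘ₗ arrowMap k X a.2.2
  map_add' h h' := by
    funext a
    simp only [Pi.add_apply, LinearMap.comp_add, LinearMap.add_comp]
    abel
  map_smul' r h := by
    funext a
    simp only [Pi.smul_apply, LinearMap.comp_smul, LinearMap.smul_comp, smul_sub,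
      RingHom.id_apply]

theorem standardDiff_apply (h : ∀ i : V, vertexSpace k X i →ₗ[k] vertexSpace k Y i)
    {i j : V} (a : i ⟶ j) (x : vertexSpace k X j) :
    standardDiff k V X Y h ⟨i, j, a⟩ x = arrowMap k Y a (h j x) - h i (arrowMap k X a x) := rfl

theorem standardDiff_eq_zero_iff {h : ∀ i : V, vertexSpace k X i →ₗ[k] vertexSpace k Y i} :
    standardDiff k V X Y h = 0 ↔
      ∀ (i j : V) (a : i ⟶ j) x, h i (arrowMap k X a x) = arrowMap k Y a (h j x) := by
  constructor
  · intro hh i j a x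
    have := LinearMap.congr_fun (congrFun hh ⟨i, j, a⟩) x
    rw [standardDiff_apply] at this
    exact (sub_eq_zero.1 this).symm
  · rintro hh
    funext ⟨i, j, a⟩
    refine LinearMap.ext fun x => ?_
    rw [standardDiff_apply, hh, sub_self]
    rfl

variable (k V X Y) in
/-- The linear map which sends a homomorphism to the family of its components. -/
def vertexMapHom : (X →ₗ[PathAlgebra k V] Y) →ₗ[k]
    (∀ i : V, vertexSpace k X i →ₗ[k] vertexSpace k Y i) where
  toFun φ i := vertexMap φ i
  map_add' _ _ := rfl
  map_smul' _ _ := rfl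

variable (k V X Y) in
/-- Homomorphisms of modules are the cocycles of degree zero of the standard complex. -/
def homEquivKer : (X →ₗ[PathAlgebra k V] Y) ≃ₗ[k] LinearMap.ker (standardDiff k V X Y) :=
  LinearEquiv.ofBijective
    (LinearMap.codRestrict _ (vertexMapHom k V X Y)
      fun φ => standardDiff_eq_zero_iff.2 fun _ _ a x => vertexMap_arrowMap φ a x)
    ⟨fun φ ψ h => hom_eq_of_vertexMap_eq (k := k) (V := V) fun i =>
        congrFun (congrArg Subtype.val h) i,
     fun h => by
      obtain ⟨φ, hφ⟩ := exists_hom_of_family (V := V) h.1 (standardDiff_eq_zero_iff.1 h.2)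
      exact ⟨φ, Subtype.ext (funext hφ)⟩⟩

end Hom

end Representation

/-! ### Vanishing of the first extension group -/

section Ext

open PathAlgebra

variable {k V : Type*} [Field k] [Fintype V] [DecidableEq V] [Quiver V]
  [∀ i j : V, Fintype (i ⟶ j)]

section Criteria

variable (k) (X : Type*) [AddCommGroup X] [Module k X] [Module (PathAlgebra k V) X]
  [IsScalarTower k (PathAlgebra k V) X]

/-- The map `⨁_{a : i ⟶ j} e_j X → e_i X` given by all the arrows which start at `i`. -/
def sumArrows (i : V) : (∀ a : Σ j : V, (i ⟶ j), vertexSpace k X a.1) →ₗ[k] vertexSpace k X i :=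
  ∑ a, arrowMap k X a.2 ∘ₗ LinearMap.proj a

/-- The map `e_j X → ⨁_{a : i ⟶ j} e_i X` given by all the arrows which end at `j`. -/
def piArrows (j : V) : vertexSpace k X j →ₗ[k] (∀ a : Σ i : V, (i ⟶ j), vertexSpace k X a.1) :=
  LinearMap.pi fun a => arrowMap k X a.2

variable (V) in
/-- All the maps `⨁_{a : i ⟶ j} e_j X → e_i X` are injective, that is, `Tor₁(S, X) = 0` for the
simple right modules `S` attached to the vertices. -/
def ArrowsInjective : Prop := ∀ i : V, Function.Injective (sumArrows k X i)

variable (V) in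
/-- All the maps `e_j X → ⨁_{a : i ⟶ j} e_i X` are surjective, that is, `Ext¹(S, X) = 0` for the
simple modules `S` attached to the vertices. -/
def ArrowsSurjective : Prop := ∀ j : V, Function.Surjective (piArrows k X j)

variable {k X}

theorem sumArrows_apply (i : V) (x : ∀ a : Σ j : V, (i ⟶ j), vertexSpace k X a.1) :
    sumArrows k X i x = ∑ a, arrowMap k X a.2 (x a) := by simp [sumArrows]

theorem piArrows_apply (j : V) (x : vertexSpace k X j) (a : Σ i : V, (i ⟶ j)) :
    piArrows k X j x a = arrowMap k X a.2 x := rfl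

theorem sumArrows_single {i : V} (a : Σ j : V, (i ⟶ j)) [DecidableEq (Σ j : V, (i ⟶ j))]
    (x : vertexSpace k X a.1) : sumArrows k X i (Pi.single a x) = arrowMap k X a.2 x := by
  rw [sumArrows_apply, Finset.sum_eq_single a]
  · simp
  · intro b _ hb
    simp [Pi.single_eq_of_ne hb]
  · simp

end Criteria

variable {X Y : Type*} [AddCommGroup X] [Module k X] [Module (PathAlgebra k V) X]
  [IsScalarTower k (PathAlgebra k V) X] [AddCommGroup Y] [Module k Y]
  [Module (PathAlgebra k V) Y] [IsScalarTower k (PathAlgebra k V) Y]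

theorem ArrowsInjective.of_jointly_injective (hY : ArrowsInjective k V Y) {ι : Type*}
    (φ : ι → X →ₗ[PathAlgebra k V] Y) (hφ : ∀ x, (∀ s, φ s x = 0) → x = 0) :
    ArrowsInjective k V X := by
  intro i
  rw [injective_iff_map_eq_zero]
  intro x hx
  funext a
  refine Subtype.ext (hφ _ fun s => ?_)
  have h : sumArrows k Y i (fun a => vertexMap (φ s) a.1 (x a)) = 0 := by
    have := congrArg (vertexMap (φ s) i) hx
    simpa [sumArrows_apply, vertexMap_arrowMap] using this
  simpa using congrArg Subtype.val (congrFun ((injective_iff_map_eq_zero _).1 (hY i) _ h) a)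

theorem ArrowsInjective.of_injective (hY : ArrowsInjective k V Y)
    {φ : X →ₗ[PathAlgebra k V] Y} (hφ : Function.Injective φ) : ArrowsInjective k V X :=
  hY.of_jointly_injective (fun _ : Unit => φ) fun _ hx => hφ ((hx ()).trans (map_zero φ).symm)

theorem ArrowsSurjective.of_surjective (hX : ArrowsSurjective k V X)
    {φ : X →ₗ[PathAlgebra k V] Y} (hφ : Function.Surjective φ) : ArrowsSurjective k V Y := by
  intro j y
  choose x hx using fun a : Σ i : V, (i ⟶ j) => vertexMap_surjective hφ a.1 (y a)
  obtain ⟨z, hz⟩ := hX j x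
  refine ⟨vertexMap φ j z, funext fun a => ?_⟩
  rw [piArrows_apply, ← vertexMap_arrowMap, ← hx a, ← hz, piArrows_apply]

theorem IsAcyclicQuiver.wellFounded_transGen {V : Type*} [Finite V] [Quiver V]
    (hV : IsAcyclicQuiver V) :
    WellFounded (Relation.TransGen fun i j : V => Nonempty (i ⟶ j)) := by
  have key : ∀ i j : V, Relation.TransGen (fun i j : V => Nonempty (i ⟶ j)) i j →
      ∃ p : Quiver.Path i j, p.length ≠ 0 := by
    intro i j h
    induction h with
    | single h => exact h.elim fun a => ⟨a.toPath, by simp⟩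
    | tail _ h ih =>
      obtain ⟨p, -⟩ := ih
      exact h.elim fun a => ⟨p.cons a, by simp⟩
  have : Std.Irrefl (Relation.TransGen fun i j : V => Nonempty (i ⟶ j)) :=
    ⟨fun i h => by obtain ⟨p, hp⟩ := key i i h; exact hp (hV i p)⟩
  exact Finite.wellFounded_of_trans_of_irrefl _

theorem IsAcyclicQuiver.wellFounded {V : Type*} [Finite V] [Quiver V]
    (hV : IsAcyclicQuiver V) : WellFounded fun i j : V => Nonempty (i ⟶ j) :=
  Subrelation.wf (fun h => Relation.TransGen.single h) hV.wellFounded_transGen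

theorem IsAcyclicQuiver.wellFounded_swap {V : Type*} [Finite V] [Quiver V]
    (hV : IsAcyclicQuiver V) : WellFounded fun j i : V => Nonempty (i ⟶ j) := by
  have : Std.Irrefl (Function.swap (Relation.TransGen fun i j : V => Nonempty (i ⟶ j))) :=
    ⟨fun i h => hV.wellFounded_transGen.irrefl.irrefl i h⟩
  have : IsTrans V (Function.swap (Relation.TransGen fun i j : V => Nonempty (i ⟶ j))) :=
    ⟨fun _ _ _ h h' => Relation.TransGen.trans h' h⟩
  exact Subrelation.wf (fun h => Relation.TransGen.single h)
    (Finite.wellFounded_of_trans_of_irrefl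
      (Function.swap (Relation.TransGen fun i j : V => Nonempty (i ⟶ j))))

/-- `Ext¹(X, Y) = 0` if `Y` satisfies the surjectivity condition: a preimage under the differential
is built by recursion along the arrows. -/
theorem standardDiff_surjective_of_arrowsSurjective (hV : IsAcyclicQuiver V)
    (hY : ArrowsSurjective k V Y) : Function.Surjective (standardDiff k V X Y) := by
  intro c
  choose s hs using fun j : V =>
    (piArrows k Y j).exists_rightInverse_of_surjective (LinearMap.range_eq_top.2 (hY j))
  let F : ∀ j : V, (∀ i : V, Nonempty (i ⟶ j) → (vertexSpace k X i →ₗ[k] vertexSpace k Y i)) →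
      (vertexSpace k X j →ₗ[k] vertexSpace k Y j) := fun j h =>
    s j ∘ₗ LinearMap.pi fun a : Σ i : V, (i ⟶ j) =>
      h a.1 ⟨a.2⟩ ∘ₗ arrowMap k X a.2 + c ⟨a.1, j, a.2⟩
  refine ⟨hV.wellFounded.fix F, ?_⟩
  funext ⟨i, j, a⟩
  refine LinearMap.ext fun x => ?_
  have h1 : arrowMap k Y a (hV.wellFounded.fix F j x) =
      hV.wellFounded.fix F i (arrowMap k X a x) + c ⟨i, j, a⟩ x := by
    rw [hV.wellFounded.fix_eq F j]
    exact congrFun (LinearMap.congr_fun (hs j) _) ⟨i, a⟩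
  rw [standardDiff_apply, h1]
  exact add_sub_cancel_left _ _

/-- `Ext¹(X, Y) = 0` if `X` satisfies the injectivity condition: a preimage under the differential
is built by recursion against the arrows. -/
theorem standardDiff_surjective_of_arrowsInjective (hV : IsAcyclicQuiver V)
    (hX : ArrowsInjective k V X) : Function.Surjective (standardDiff k V X Y) := by
  classical
  intro c
  choose s hs using fun i : V =>
    (sumArrows k X i).exists_leftInverse_of_injective (LinearMap.ker_eq_bot.2 (hX i))
  let F : ∀ i : V, (∀ j : V, Nonempty (i ⟶ j) → (vertexSpace k X j →ₗ[k] vertexSpace k Y j)) →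
      (vertexSpace k X i →ₗ[k] vertexSpace k Y i) := fun i h =>
    (∑ a : Σ j : V, (i ⟶ j),
      (arrowMap k Y a.2 ∘ₗ h a.1 ⟨a.2⟩ - c ⟨i, a.1, a.2⟩) ∘ₗ LinearMap.proj a) ∘ₗ s i
  refine ⟨hV.wellFounded_swap.fix F, ?_⟩
  funext ⟨i, j, a⟩
  refine LinearMap.ext fun x => ?_
  have h1 : hV.wellFounded_swap.fix F i (arrowMap k X a x) =
      arrowMap k Y a (hV.wellFounded_swap.fix F j x) - c ⟨i, j, a⟩ x := by
    rw [hV.wellFounded_swap.fix_eq F i]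
    have h2 : s i (arrowMap k X a x) =
        Pi.single (M := fun a : Σ j : V, (i ⟶ j) => vertexSpace k X a.1) ⟨j, a⟩ x := by
      rw [← sumArrows_single (⟨j, a⟩ : Σ j : V, (i ⟶ j)) x]
      exact LinearMap.congr_fun (hs i) _
    simp only [F, LinearMap.comp_apply, LinearMap.sum_apply, h2]
    rw [Finset.sum_eq_single ⟨j, a⟩]
    · simp
    · intro b _ hb
      simp [Pi.single_eq_of_ne hb]
    · simp
  rw [standardDiff_apply, h1]
  exact sub_sub_cancel _ _

/-- If `Ext¹(X, ker π)` vanishes then a surjection `π` onto `X` splits: a `k`-linear section is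
corrected by a preimage of its defect of linearity. -/
theorem exists_section_of_standardDiff_surjective {π : Y →ₗ[PathAlgebra k V] X}
    (hπ : Function.Surjective π)
    (h : Function.Surjective (standardDiff k V X (LinearMap.ker π))) :
    ∃ s : X →ₗ[PathAlgebra k V] Y, π ∘ₗ s = LinearMap.id := by
  choose t ht using fun i : V => (vertexMap π i).exists_rightInverse_of_surjective
    (LinearMap.range_eq_top.2 (vertexMap_surjective hπ i))
  have ht' : ∀ i x, vertexMap π i (t i x) = x := fun i x => LinearMap.congr_fun (ht i) x
  let ι := (LinearMap.ker π).subtype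
  have hι : ∀ (i : V) (y : vertexSpace k Y i), vertexMap π i y = 0 →
      ∃ z, vertexMap ι i z = y := fun i y hy =>
    ⟨⟨⟨y, by simpa using congrArg Subtype.val hy⟩, by
      rw [mem_vertexSpace]; exact Subtype.ext (idem_smul_coe y)⟩, Subtype.ext rfl⟩
  choose r hr using fun i : V => (vertexMap ι i).exists_leftInverse_of_injective
    (LinearMap.ker_eq_bot.2 (vertexMap_injective (Submodule.subtype_injective _) i))
  have hr' : ∀ i y, vertexMap π i y = 0 → vertexMap ι i (r i y) = y := by
    intro i y hy
    obtain ⟨z, rfl⟩ := hι i y hy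
    exact congrArg _ (LinearMap.congr_fun (hr i) z)
  have hπι : ∀ i z, vertexMap π i (vertexMap ι i z) = 0 := fun i z =>
    Subtype.ext (z : LinearMap.ker π).2
  obtain ⟨u, hu⟩ := h fun a => r a.1 ∘ₗ standardDiff k V X Y t a
  obtain ⟨s, hs⟩ := exists_hom_of_family (V := V) (fun i => t i - vertexMap ι i ∘ₗ u i) (by
    intro i j a x
    have h1 := congrArg (vertexMap ι i) (LinearMap.congr_fun (congrFun hu ⟨i, j, a⟩) x)
    rw [standardDiff_apply, LinearMap.comp_apply, hr', standardDiff_apply, map_sub,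
      vertexMap_arrowMap] at h1
    · simp only [LinearMap.sub_apply, LinearMap.comp_apply, map_sub]
      rw [sub_eq_sub_iff_sub_eq_sub]
      rw [← neg_sub, ← h1, neg_sub]
    · rw [standardDiff_apply, map_sub, vertexMap_arrowMap, ht', ht', sub_self])
  refine ⟨s, hom_eq_of_vertexMap_eq (k := k) (V := V) fun i => ?_⟩
  refine LinearMap.ext fun x => ?_
  have h2 : vertexMap (π ∘ₗ s) i x = vertexMap π i (vertexMap s i x) := rfl
  rw [h2, hs]
  simp only [LinearMap.sub_apply, LinearMap.comp_apply, map_sub, hπι, sub_zero, ht']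
  rfl

/-- If `Ext¹(coker ι, X)` vanishes then homomorphisms to `X` extend along the injection `ι`: a
`k`-linear extension is corrected by a preimage of its defect of linearity. -/
theorem exists_extension_of_standardDiff_surjective {Z : Type*} [AddCommGroup Z] [Module k Z]
    [Module (PathAlgebra k V) Z] [IsScalarTower k (PathAlgebra k V) Z]
    {ι : Z →ₗ[PathAlgebra k V] Y} (hι : Function.Injective ι)
    (h : Function.Surjective (standardDiff k V (Y ⧸ LinearMap.range ι) X))
    (φ : Z →ₗ[PathAlgebra k V] X) : ∃ ψ : Y →ₗ[PathAlgebra k V] X, ψ ∘ₗ ι = φ := by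
  choose r hr using fun i : V => (vertexMap ι i).exists_leftInverse_of_injective
    (LinearMap.ker_eq_bot.2 (vertexMap_injective hι i))
  have hr' : ∀ i z, r i (vertexMap ι i z) = z := fun i z => LinearMap.congr_fun (hr i) z
  let t : ∀ i : V, vertexSpace k Y i →ₗ[k] vertexSpace k X i := fun i => vertexMap φ i ∘ₗ r i
  let π := (LinearMap.range ι).mkQ
  choose s hs using fun i : V => (vertexMap π i).exists_rightInverse_of_surjective
    (LinearMap.range_eq_top.2 (vertexMap_surjective (Submodule.mkQ_surjective _) i))
  have hs' : ∀ i x, vertexMap π i (s i x) = x := fun i x => LinearMap.congr_fun (hs i) x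
  have hπι : ∀ i z, vertexMap π i (vertexMap ι i z) = 0 := fun i z =>
    Subtype.ext ((Submodule.Quotient.mk_eq_zero _).2 ⟨z, rfl⟩)
  have hker : ∀ (i : V) (y : vertexSpace k Y i), vertexMap π i y = 0 →
      ∃ z, vertexMap ι i z = y := by
    intro i y hy
    obtain ⟨z, hz⟩ := (Submodule.Quotient.mk_eq_zero (LinearMap.range ι)).1
      (show (LinearMap.range ι).mkQ (y : Y) = 0 from congrArg Subtype.val hy)
    exact ⟨vertexProj k Z i z, Subtype.ext (by simp [hz, idem_smul_coe])⟩
  -- The defect of linearity of `t` vanishes on the image of `ι`, hence factors through `π`.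
  have hdef : ∀ (i j : V) (a : i ⟶ j) (y : vertexSpace k Y j),
      standardDiff k V Y X t ⟨i, j, a⟩ (s j (vertexMap π j y)) =
        standardDiff k V Y X t ⟨i, j, a⟩ y := by
    intro i j a y
    obtain ⟨z, hz⟩ := hker j (s j (vertexMap π j y) - y) (by rw [map_sub, hs', sub_self])
    rw [← sub_eq_zero, ← map_sub, ← hz, standardDiff_apply, ← vertexMap_arrowMap]
    simp only [t, LinearMap.comp_apply, ← vertexMap_arrowMap, hr', sub_self]
  obtain ⟨u, hu⟩ := h fun a => standardDiff k V Y X t a ∘ₗ s a.2.1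
  obtain ⟨ψ, hψ⟩ := exists_hom_of_family (V := V) (fun i => t i - u i ∘ₗ vertexMap π i) (by
    intro i j a y
    have h1 := LinearMap.congr_fun (congrFun hu ⟨i, j, a⟩) (vertexMap π j y)
    rw [standardDiff_apply, LinearMap.comp_apply, hdef, standardDiff_apply,
      ← vertexMap_arrowMap] at h1
    simp only [LinearMap.sub_apply, LinearMap.comp_apply, map_sub]
    rw [sub_eq_sub_iff_sub_eq_sub]
    rw [← neg_sub, ← h1, neg_sub])
  refine ⟨ψ, hom_eq_of_vertexMap_eq (k := k) (V := V) fun i => ?_⟩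
  refine LinearMap.ext fun z => ?_
  have h2 : vertexMap (ψ ∘ₗ ι) i z = vertexMap ψ i (vertexMap ι i z) := rfl
  rw [h2, hψ]
  simp only [t, LinearMap.sub_apply, LinearMap.comp_apply, hπι, hr', map_zero, sub_zero]

theorem ArrowsInjective.projective (hV : IsAcyclicQuiver V) (hX : ArrowsInjective k V X) :
    Module.Projective (PathAlgebra k V) X :=
  Module.Projective.of_lifting_property'' fun _ hf =>
    exists_section_of_standardDiff_surjective hf
      (standardDiff_surjective_of_arrowsInjective hV hX)

theorem ArrowsSurjective.injective (hV : IsAcyclicQuiver V) (hX : ArrowsSurjective k V X) :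
    Module.Injective (PathAlgebra k V) X := by
  refine ⟨fun Z Y _ _ _ _ ι hι φ => ?_⟩
  let := Module.compHom Z (algebraMap k (PathAlgebra k V))
  let := Module.compHom Y (algebraMap k (PathAlgebra k V))
  have : IsScalarTower k (PathAlgebra k V) Z := IsScalarTower.of_algebraMap_smul fun _ _ => rfl
  have : IsScalarTower k (PathAlgebra k V) Y := IsScalarTower.of_algebraMap_smul fun _ _ => rfl
  obtain ⟨ψ, hψ⟩ := exists_extension_of_standardDiff_surjective hι
    (standardDiff_surjective_of_arrowsSurjective hV hX) φ
  exact ⟨ψ, fun z => LinearMap.congr_fun hψ z⟩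

/-- If `Ext¹(X, Y)` vanishes then `dim Hom(X, Y)` is the value of the Euler form. -/
theorem homDim_eq_of_standardDiff_surjective [Module.Finite k X] [Module.Finite k Y]
    (h : Function.Surjective (standardDiff k V X Y)) :
    (homDim k (PathAlgebra k V) X Y : ℤ) = ∑ i : V, (dimVec k X i : ℤ) * dimVec k Y i -
      ∑ i : V, ∑ j : V, arrowCount i j * dimVec k X j * dimVec k Y i := by
  have h1 := (standardDiff k V X Y).finrank_range_add_finrank_ker
  rw [LinearMap.range_eq_top.2 h, finrank_top, ← (homEquivKer k V X Y).finrank_eq,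
    Module.finrank_pi_fintype, Module.finrank_pi_fintype] at h1
  simp only [Module.finrank_linearMap, ← dimVec_eq] at h1
  have h2 : ∑ a : Σ i j : V, (i ⟶ j), dimVec k X a.2.1 * dimVec k Y a.1 =
      ∑ i : V, ∑ j : V, Fintype.card (i ⟶ j) * dimVec k X j * dimVec k Y i := by
    rw [Fintype.sum_sigma]
    refine Finset.sum_congr rfl fun i _ => ?_
    rw [Fintype.sum_sigma]
    refine Finset.sum_congr rfl fun j _ => ?_
    simp [mul_assoc]
  rw [h2] at h1
  rw [homDim, eq_sub_iff_add_eq']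
  simp only [arrowCount]
  exact_mod_cast h1

end Ext

/-! ### The Nakayama functor -/

section NakayamaHom

variable {k A : Type*} [Field k] [Ring A] [Algebra k A]

namespace Nakayama

variable {P : Type*} [AddCommGroup P] [Module A P]

/-- The value of an element of `ν(P) = Hom_k(Hom_A(P, A), k)` at a homomorphism `P → A`. -/
def eval (ξ : Nakayama k A P) (φ : P →ₗ[A] A) : k := (show Module.Dual k (P →ₗ[A] A) from ξ) φ

theorem ext_eval {ξ η : Nakayama k A P} (h : ∀ φ, eval ξ φ = eval η φ) : ξ = η := LinearMap.ext h

theorem eval_smul (a : A) (ξ : Nakayama k A P) (φ : P →ₗ[A] A) :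
    eval (a • ξ) φ = eval ξ (rightMul k A P a φ) := rfl

theorem rightMul_apply (a : A) (φ : P →ₗ[A] A) (p : P) : rightMul k A P a φ p = φ p * a := rfl

variable {U : Type*} [AddCommGroup U] [Module k U] [Module A U] [IsScalarTower k A U]

variable (k P) in
/-- The map `Hom_A(P, A) → Hom_A(P, U)` which sends `φ` to `p ↦ φ(p) u`. -/
def smulVec (u : U) : (P →ₗ[A] A) →ₗ[k] (P →ₗ[A] U) where
  toFun φ := LinearMap.toSpanSingleton A U u ∘ₗ φ
  map_add' φ ψ := by ext; simp [add_smul]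
  map_smul' r φ := by ext; simp

theorem smulVec_apply (u : U) (φ : P →ₗ[A] A) (p : P) : smulVec k P u φ p = φ p • u := rfl

variable (k A P U) in
/-- The map `D Hom_A(P, U) → Hom_A(U, ν(P))` which sends `l` to `u ↦ (φ ↦ l(p ↦ φ(p) u))`. -/
def ofDualHom : Module.Dual k (P →ₗ[A] U) →ₗ[k] (U →ₗ[A] Nakayama k A P) where
  toFun l :=
    { toFun := fun u => l ∘ₗ smulVec k P u
      map_add' := fun u v => ext_eval fun φ => by
        change l _ = l _ + l _
        rw [← map_add]
        congr 1
        ext p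
        simp [smulVec_apply]
      map_smul' := fun a u => ext_eval fun φ => by
        change l _ = l _
        congr 1
        ext p
        simp [smulVec_apply, rightMul_apply, mul_smul] }
  map_add' _ _ := rfl
  map_smul' _ _ := rfl

theorem eval_ofDualHom (l : Module.Dual k (P →ₗ[A] U)) (u : U) (φ : P →ₗ[A] A) :
    eval (ofDualHom k A P U l u) φ = l (smulVec k P u φ) := rfl

/-- Finitely generated projective modules have finite dual bases. -/
theorem _root_.Module.Projective.exists_finite_dualBasis (A P : Type*) [Ring A] [AddCommGroup P]
    [Module A P] [Module.Finite A P] [Module.Projective A P] :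
    ∃ (n : ℕ) (p : Fin n → P) (φ : Fin n → (P →ₗ[A] A)), ∀ x, ∑ s, φ s x • p s = x := by
  obtain ⟨n, π, ι, -, -, h⟩ := Module.Finite.exists_comp_eq_id_of_projective A P
  refine ⟨n, fun s => π fun j => if s = j then 1 else 0, fun s => LinearMap.proj s ∘ₗ ι,
    fun x => ?_⟩
  have h1 := LinearMap.congr_fun h x
  rw [LinearMap.comp_apply, LinearMap.pi_apply_eq_sum_univ π (ι x)] at h1
  exact h1

variable (k A P U) in
/-- The isomorphism `D Hom(P, U) ≅ Hom(U, ν(P))`: a finite dual basis of `P` gives the inverse. -/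
theorem ofDualHom_bijective [Module.Finite A P] [Module.Projective A P] :
    Function.Bijective (ofDualHom k A P U) := by
  obtain ⟨n, p, φ, h⟩ := Module.Projective.exists_finite_dualBasis A P
  constructor
  · rw [injective_iff_map_eq_zero]
    intro l hl
    refine LinearMap.ext fun θ => ?_
    have h1 : θ = ∑ s, smulVec k P (θ (p s)) (φ s) := by
      ext x
      conv_lhs => rw [← h x]
      simp [smulVec_apply]
    rw [h1, map_sum, LinearMap.zero_apply]
    refine Finset.sum_eq_zero fun s _ => ?_
    rw [← eval_ofDualHom, hl]
    rfl
  · intro g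
    let gk : U →ₗ[k] Module.Dual k (P →ₗ[A] A) :=
      { toFun := fun u => g u
        map_add' := fun u v => map_add g u v
        map_smul' := fun r u => by
          rw [← algebraMap_smul A r u, map_smul, algebraMap_smul]
          rfl }
    let ev : ∀ s, (P →ₗ[A] U) →ₗ[k] U := fun s =>
      { toFun := fun θ => θ (p s), map_add' := fun _ _ => rfl, map_smul' := fun _ _ => rfl }
    refine ⟨∑ s, gk.flip (φ s) ∘ₗ ev s, ?_⟩
    refine LinearMap.ext fun u => ext_eval fun ψ => ?_
    have h2 : ψ = ∑ s, rightMul k A P (ψ (p s)) (φ s) := by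
      ext x
      conv_lhs => rw [← h x]
      simp [rightMul_apply]
    have h3 : eval (g u) ψ = ∑ s, eval (g u) (rightMul k A P (ψ (p s)) (φ s)) := by
      conv_lhs => rw [h2]
      exact map_sum (gk u) _ _
    rw [h3, eval_ofDualHom, LinearMap.sum_apply]
    refine Finset.sum_congr rfl fun s _ => ?_
    rw [← eval_smul, ← map_smul]
    rfl

/-- The defining property of the Nakayama functor: `dim Hom(U, ν(P)) = dim Hom(P, U)`. -/
theorem homDim_nakayama (k A P U : Type*) [Field k] [Ring A] [Algebra k A] [AddCommGroup P]
    [Module A P] [AddCommGroup U] [Module k U] [Module A U] [IsScalarTower k A U]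
    [Module.Finite A P] [Module.Projective A P] :
    homDim k A U (Nakayama k A P) = homDim k A P U := by
  rw [homDim, homDim, ← (LinearEquiv.ofBijective _ (ofDualHom_bijective k A P U)).finrank_eq,
    Subspace.dual_finrank_eq]

end Nakayama

theorem finite_hom (k A X Y : Type*) [Field k] [Ring A] [Algebra k A] [AddCommGroup X]
    [Module k X] [Module A X] [IsScalarTower k A X] [AddCommGroup Y] [Module k Y] [Module A Y]
    [IsScalarTower k A Y] [Module.Finite k X] [Module.Finite k Y] :
    Module.Finite k (X →ₗ[A] Y) :=
  Module.Finite.of_injective (LinearMap.restrictScalarsₗ k A X Y k)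
    (LinearMap.restrictScalars_injective k)

instance Nakayama.finite (k A P : Type*) [Field k] [Ring A] [Algebra k A] [AddCommGroup P]
    [Module k P] [Module A P] [IsScalarTower k A P] [Module.Finite k P] [Module.Finite k A] :
    Module.Finite k (Nakayama k A P) :=
  have := finite_hom k A P A
  inferInstanceAs (Module.Finite k (Module.Dual k (P →ₗ[A] A)))

end NakayamaHom

/-! ### Projective modules and their images under the Nakayama functor -/

section PathAlgebraProjective

namespace PathAlgebra

/-- A path determines its initial arrow and the rest of the path. -/
theorem toPath_comp_injective {V : Type*} [Quiver V] {i j j' l : V} (a : i ⟶ j) (a' : i ⟶ j')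
    (q : Quiver.Path j l) (q' : Quiver.Path j' l) (h : a.toPath.comp q = a'.toPath.comp q') :
    (⟨⟨j, a⟩, q⟩ : Σ b : (Σ j, (i ⟶ j)), Quiver.Path b.1 l) = ⟨⟨j', a'⟩, q'⟩ := by
  induction q with
  | nil =>
    cases q' with
    | nil => cases h; rfl
    | cons q' b =>
      have := congrArg Quiver.Path.length h
      simp [Quiver.Path.length_comp] at this
  | cons q b ih =>
    cases q' with
    | nil =>
      have := congrArg Quiver.Path.length h
      simp [Quiver.Path.length_comp] at this
    | cons q' b' =>
      rw [Quiver.Path.comp_cons, Quiver.Path.comp_cons] at h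
      obtain rfl := Quiver.Path.obj_eq_of_cons_eq_cons h
      have h1 := eq_of_heq (Quiver.Path.heq_of_cons_eq_cons h)
      have h2 := eq_of_heq (Quiver.Path.hom_heq_of_cons_eq_cons h)
      cases ih q' h1
      rw [h2]

variable (k : Type*) {V : Type*} [Field k] [Fintype V] [DecidableEq V] [Quiver V]

/-- The linear map which removes the initial arrow `a` from all paths which start with `a`, and
kills all other paths. -/
def removeFirst {i j : V} (a : i ⟶ j) : PathAlgebra k V →ₗ[k] PathAlgebra k V :=
  (basis k).constr k (Function.extend
    (fun q : Σ l, Quiver.Path j l => (⟨i, q.1, a.toPath.comp q.2⟩ : Σ i l : V, Quiver.Path i l))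
    (fun q => ofPath k q.2) 0)

/-- The linear map which removes the final arrow `a` from all paths which end with `a`, and
kills all other paths. -/
def removeLast {i j : V} (a : i ⟶ j) : PathAlgebra k V →ₗ[k] PathAlgebra k V :=
  (basis k).constr k (Function.extend
    (fun q : Σ l, Quiver.Path l i => (⟨q.1, j, q.2.cons a⟩ : Σ i l : V, Quiver.Path i l))
    (fun q => ofPath k q.2) 0)

variable {k}

theorem removeFirst_arrow_mul {i j : V} (a : i ⟶ j) (x : PathAlgebra k V) :
    removeFirst k a (arrow k a * x) = idem k j * x := by
  have key : removeFirst k a ∘ₗ mulHom k V (arrow k a) = mulHom k V (idem k j) := by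
    refine hom_ext k fun i' l q => ?_
    change removeFirst k a (ofPath k a.toPath * ofPath k q) = ofPath k _ * ofPath k q
    by_cases h : i' = j
    · subst h
      rw [ofPath_mul_comp, ofPath_mul_comp, Quiver.Path.nil_comp, removeFirst, ofPath,
        Module.Basis.constr_basis]
      refine Function.Injective.extend_apply (f := fun q : Σ l, Quiver.Path i' l =>
        (⟨i, q.1, a.toPath.comp q.2⟩ : Σ i l : V, Quiver.Path i l)) ?_ _ _ ⟨l, q⟩
      rintro ⟨l₁, q₁⟩ ⟨l₂, q₂⟩ h
      simp only [Sigma.mk.injEq, heq_eq_eq, true_and] at h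
      obtain ⟨rfl, h⟩ := h
      cases toPath_comp_injective a a q₁ q₂ (eq_of_heq h)
      rfl
    · rw [ofPath_mul_ne k V _ _ h, ofPath_mul_ne k V _ _ h, map_zero]
  exact LinearMap.congr_fun key x

theorem removeFirst_arrow_mul_ne {i j j' : V} (a : i ⟶ j) (a' : i ⟶ j')
    (hne : (⟨j', a'⟩ : Σ j : V, (i ⟶ j)) ≠ ⟨j, a⟩) (x : PathAlgebra k V) :
    removeFirst k a (arrow k a' * x) = 0 := by
  have key : removeFirst k a ∘ₗ mulHom k V (arrow k a') = 0 := by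
    refine hom_ext k fun i' l q => ?_
    change removeFirst k a (ofPath k a'.toPath * ofPath k q) = 0
    by_cases h : i' = j'
    · subst h
      rw [ofPath_mul_comp, removeFirst, ofPath, Module.Basis.constr_basis]
      refine Function.extend_apply' _ _ _ ?_
      rintro ⟨⟨l₁, q₁⟩, h⟩
      simp only [Sigma.mk.injEq, heq_eq_eq, true_and] at h
      obtain ⟨rfl, h⟩ := h
      cases toPath_comp_injective a a' q₁ q (eq_of_heq h)
      exact hne rfl
    · rw [ofPath_mul_ne k V _ _ h, map_zero]
  exact LinearMap.congr_fun key x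

theorem removeLast_mul_arrow {i j : V} (a : i ⟶ j) (x : PathAlgebra k V) :
    removeLast k a (x * arrow k a) = x * idem k i := by
  have key : removeLast k a ∘ₗ (mulHom k V).flip (arrow k a) = (mulHom k V).flip (idem k i) := by
    refine hom_ext k fun l i' q => ?_
    change removeLast k a (ofPath k q * ofPath k a.toPath) = ofPath k q * ofPath k _
    by_cases h : i = i'
    · subst h
      rw [ofPath_mul_comp, ofPath_mul_comp, Quiver.Path.comp_nil, removeLast, ofPath,
        Module.Basis.constr_basis]
      refine Function.Injective.extend_apply (f := fun q : Σ l, Quiver.Path l i =>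
        (⟨q.1, j, q.2.cons a⟩ : Σ i l : V, Quiver.Path i l)) ?_ _ _ ⟨l, q⟩
      rintro ⟨l₁, q₁⟩ ⟨l₂, q₂⟩ h
      cases h
      rfl
    · rw [ofPath_mul_ne k V _ _ h, ofPath_mul_ne k V _ _ h, map_zero]
  exact LinearMap.congr_fun key x

theorem removeLast_mul_arrow_ne {i i' j : V} (a : i ⟶ j) (a' : i' ⟶ j)
    (hne : (⟨i', a'⟩ : Σ i : V, (i ⟶ j)) ≠ ⟨i, a⟩) (x : PathAlgebra k V) :
    removeLast k a (x * arrow k a') = 0 := by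
  have key : removeLast k a ∘ₗ (mulHom k V).flip (arrow k a') = 0 := by
    refine hom_ext k fun l l' q => ?_
    change removeLast k a (ofPath k q * ofPath k a'.toPath) = 0
    by_cases h : i' = l'
    · subst h
      rw [ofPath_mul_comp, removeLast, ofPath, Module.Basis.constr_basis]
      refine Function.extend_apply' _ _ _ ?_
      rintro ⟨⟨l₁, q₁⟩, h⟩
      cases h
      exact hne rfl
    · rw [ofPath_mul_ne k V _ _ h, map_zero]
  exact LinearMap.congr_fun key x

end PathAlgebra

open PathAlgebra

theorem IsAcyclicQuiver.finite_path {V : Type*} [Finite V] [Quiver V]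
    [∀ i j : V, Finite (i ⟶ j)] (hV : IsAcyclicQuiver V) (i j : V) :
    Finite (Quiver.Path i j) := by
  induction j using hV.wellFounded.induction with
  | _ j ih =>
    have h1 : ∀ b : Σ l : V, (l ⟶ j), Finite (Quiver.Path i b.1) := fun b => ih b.1 ⟨b.2⟩
    have h2 : Finite (PLift (i = j)) := inferInstance
    let F : PLift (i = j) ⊕ (Σ b : (Σ l : V, (l ⟶ j)), Quiver.Path i b.1) → Quiver.Path i j :=
      Sum.elim (fun h => h.down ▸ Quiver.Path.nil) fun p => p.2.cons p.1.2
    refine Finite.of_surjective F ?_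
    rintro (_ | ⟨p, a⟩)
    · exact ⟨Sum.inl ⟨rfl⟩, rfl⟩
    · exact ⟨Sum.inr ⟨⟨_, a⟩, p⟩, rfl⟩

variable {k V : Type*} [Field k] [Fintype V] [DecidableEq V] [Quiver V]
  [∀ i j : V, Fintype (i ⟶ j)]

theorem PathAlgebra.finite (hV : IsAcyclicQuiver V) : Module.Finite k (PathAlgebra k V) := by
  have := fun i j : V => hV.finite_path i j
  exact Module.Finite.of_basis (PathAlgebra.basis k)

/-- Distinct arrows, followed by any paths, give distinct paths. -/
theorem arrowsInjective_pathAlgebra : ArrowsInjective k V (PathAlgebra k V) := by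
  intro i
  rw [injective_iff_map_eq_zero]
  intro x hx
  funext ⟨j, a⟩
  have h := congrArg
    (fun y : vertexSpace k (PathAlgebra k V) i => removeFirst k a (y : PathAlgebra k V)) hx
  simp only [sumArrows_apply, Submodule.coe_sum, coe_arrowMap, smul_eq_mul, map_sum] at h
  rw [Finset.sum_eq_single ⟨j, a⟩] at h
  · rw [removeFirst_arrow_mul, ← smul_eq_mul, idem_smul_coe] at h
    exact Subtype.ext (by simpa using h)
  · exact fun b _ hb => removeFirst_arrow_mul_ne a b.2 hb _
  · simp

/-- A projective module embeds into a free module, and free modules satisfy the injectivity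
condition. -/
theorem arrowsInjective_of_projective (P : Type*) [AddCommGroup P] [Module k P]
    [Module (PathAlgebra k V) P] [IsScalarTower k (PathAlgebra k V) P]
    [Module.Projective (PathAlgebra k V) P] : ArrowsInjective k V P := by
  obtain ⟨s, hs⟩ := Module.projective_def'.1
    (inferInstance : Module.Projective (PathAlgebra k V) P)
  refine arrowsInjective_pathAlgebra.of_jointly_injective
    (fun p : P => Finsupp.lapply p ∘ₗ s) fun x hx => ?_
  have h1 : s x = 0 := Finsupp.ext hx
  have h2 := LinearMap.congr_fun hs x
  rw [LinearMap.comp_apply, h1, map_zero] at h2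
  exact h2.symm

/-- The image of any module under the Nakayama functor satisfies the surjectivity condition, since
a functional which vanishes on the kernel of a linear map factors through this map. -/
theorem arrowsSurjective_nakayama (P : Type*) [AddCommGroup P] [Module (PathAlgebra k V) P] :
    ArrowsSurjective k V (Nakayama k (PathAlgebra k V) P) := by
  classical
  intro j y
  -- `x` is a solution iff `x ∘ T = η`, and `ker T ⊆ ker η` since paths with distinct final arrows
  -- are distinct.
  let T : (∀ _ : Σ i : V, (i ⟶ j), P →ₗ[PathAlgebra k V] PathAlgebra k V) →ₗ[k]
      (P →ₗ[PathAlgebra k V] PathAlgebra k V) :=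
    ∑ a, Nakayama.rightMul k (PathAlgebra k V) P (arrow k a.2) ∘ₗ LinearMap.proj a
  let η : Module.Dual k (∀ _ : Σ i : V, (i ⟶ j), P →ₗ[PathAlgebra k V] PathAlgebra k V) :=
    ∑ a, (show Module.Dual k (P →ₗ[PathAlgebra k V] PathAlgebra k V) from (y a).1) ∘ₗ
      LinearMap.proj a
  have hT : ∀ φ, T φ = ∑ a, Nakayama.rightMul k (PathAlgebra k V) P (arrow k a.2) (φ a) :=
    fun φ => by simp [T]
  have hη : ∀ φ, η φ = ∑ a, Nakayama.eval (y a).1 (φ a) := fun φ => by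
    simp only [η, LinearMap.sum_apply]
    rfl
  have hmem : η ∈ (LinearMap.ker T).dualAnnihilator := by
    rw [Submodule.mem_dualAnnihilator]
    intro φ hφ
    rw [hη]
    refine Finset.sum_eq_zero fun a _ => ?_
    rw [← idem_smul_coe (y a), Nakayama.eval_smul]
    have : Nakayama.rightMul k (PathAlgebra k V) P (idem k a.1) (φ a) = 0 := by
      ext p
      rw [Nakayama.rightMul_apply, LinearMap.zero_apply, ← removeLast_mul_arrow a.2]
      have h := congrArg (removeLast k a.2) (LinearMap.congr_fun ((hT φ).symm.trans hφ) p)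
      rw [LinearMap.sum_apply, map_sum, LinearMap.zero_apply, map_zero,
        Finset.sum_eq_single a] at h
      · exact h
      · exact fun b _ hb => removeLast_mul_arrow_ne a.2 b.2 hb _
      · simp
    rw [this]
    exact map_zero (show Module.Dual k (P →ₗ[PathAlgebra k V] PathAlgebra k V) from (y a).1)
  rw [← LinearMap.range_dualMap_eq_dualAnnihilator_ker] at hmem
  obtain ⟨x, hx⟩ := hmem
  let ξ : Nakayama k (PathAlgebra k V) P := x
  refine ⟨vertexProj k _ j ξ, funext fun a => Subtype.ext (Nakayama.ext_eval fun φ => ?_)⟩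
  rw [piArrows_apply, coe_arrowMap, coe_vertexProj, arrow_smul_idem_smul, Nakayama.eval_smul]
  have h := LinearMap.congr_fun hx (Pi.single a φ)
  rw [LinearMap.dualMap_apply, hT, hη, Finset.sum_eq_single a, Finset.sum_eq_single a,
    Pi.single_eq_same] at h
  · exact h
  · intro b _ hb
    rw [Pi.single_eq_of_ne hb]
    exact map_zero (show Module.Dual k (P →ₗ[PathAlgebra k V] PathAlgebra k V) from (y b).1)
  · simp
  · intro b _ hb
    rw [Pi.single_eq_of_ne hb, map_zero]
  · simp

end PathAlgebraProjective

/-! ### Socles and radicals -/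

section SocleRadical

open PathAlgebra

variable {k V : Type*} [Field k] [Fintype V] [DecidableEq V] [Quiver V]

section

variable (k V) (X : Type*) [AddCommGroup X] [Module k X] [Module (PathAlgebra k V) X]
  [IsScalarTower k (PathAlgebra k V) X]

/-- The submodule of all elements which are killed by all arrows. -/
def arrowSocle : Submodule (PathAlgebra k V) X where
  carrier := {x | ∀ (i j : V) (a : i ⟶ j), arrow k a • x = 0}
  add_mem' hx hy i j a := by rw [smul_add, hx i j a, hy i j a, add_zero]
  zero_mem' i j a := smul_zero _
  smul_mem' r x hx := by
    let S : Submodule k X :=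
      ⨅ (i : V) (j : V) (a : i ⟶ j), LinearMap.ker (Algebra.lsmul k k X (arrow k a))
    have hS : ∀ y, y ∈ S ↔ ∀ (i j : V) (a : i ⟶ j), arrow k a • y = 0 := by simp [S]
    refine (hS _).1 (smul_mem_of_arrow_smul_mem S ?_ ?_ r ((hS x).2 hx))
    · intro l y hy
      rw [hS] at hy ⊢
      intro i j a
      rw [← mul_smul]
      by_cases h : l = j
      · subst h
        rw [arrow_mul_idem, hy]
      · rw [arrow, ofPath_mul_idem_ne _ h, zero_smul]
    · intro i j a y hy
      rw [(hS y).1 hy]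
      exact S.zero_mem

variable {k V X} in
theorem mem_arrowSocle {x : X} :
    x ∈ arrowSocle k V X ↔ ∀ (i j : V) (a : i ⟶ j), arrow k a • x = 0 := Iff.rfl

variable {k V X} in
/-- A nonzero element of a component which is killed by all arrows spans a one-dimensional, hence
simple, submodule. -/
theorem isSimpleModule_span_of_mem_arrowSocle {i : V} {x : X} (hx : x ∈ arrowSocle k V X)
    (hi : x ∈ vertexSpace k X i) (h0 : x ≠ 0) :
    IsSimpleModule (PathAlgebra k V) (Submodule.span (PathAlgebra k V) {x}) := by
  have hk : ∀ y ∈ Submodule.span (PathAlgebra k V) {x}, ∃ c : k, c • x = y := by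
    intro y hy
    obtain ⟨r, rfl⟩ := Submodule.mem_span_singleton.1 hy
    refine Submodule.mem_span_singleton.1
      (smul_mem_of_arrow_smul_mem (k ∙ x) ?_ ?_ r (Submodule.mem_span_singleton_self x))
    · intro l z hz
      obtain ⟨c, rfl⟩ := Submodule.mem_span_singleton.1 hz
      rw [smul_comm]
      refine Submodule.smul_mem _ _ ?_
      by_cases h : l = i
      · subst h
        rw [mem_vertexSpace.1 hi]
        exact Submodule.mem_span_singleton_self x
      · rw [idem_smul_coe_ne h ⟨x, hi⟩]
        exact Submodule.zero_mem _
    · intro l m a z hz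
      obtain ⟨c, rfl⟩ := Submodule.mem_span_singleton.1 hz
      rw [smul_comm, mem_arrowSocle.1 hx, smul_zero]
      exact Submodule.zero_mem _
  rw [isSimpleModule_iff_isAtom]
  refine ⟨by simpa using h0, fun W hW => ?_⟩
  by_contra hne
  obtain ⟨w, hw, hw0⟩ := Submodule.exists_mem_ne_zero_of_ne_bot hne
  obtain ⟨c, rfl⟩ := hk w (hW.le hw)
  have hc : c ≠ 0 := fun h => hw0 (by rw [h, zero_smul])
  refine hW.not_ge ((Submodule.span_singleton_le_iff_mem _ _).2 ?_)
  have := W.smul_mem (algebraMap k (PathAlgebra k V) c⁻¹) hw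
  rwa [algebraMap_smul, inv_smul_smul₀ hc] at this

variable {X} in
/-- Arrows kill simple modules: a component at a vertex which is minimal among those with a nonzero
component is killed by all arrows. -/
theorem arrowSocle_eq_top_of_isSimpleModule (hV : IsAcyclicQuiver V)
    [IsSimpleModule (PathAlgebra k V) X] : arrowSocle k V X = ⊤ := by
  refine (eq_bot_or_eq_top (arrowSocle k V X)).resolve_left fun hbot => ?_
  have hne : {i : V | vertexSpace k X i ≠ ⊥}.Nonempty := by
    by_contra hempty
    have := IsSimpleModule.nontrivial (PathAlgebra k V) X
    obtain ⟨x, hx⟩ := exists_ne (0 : X)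
    refine hx ?_
    rw [← sum_idem_smul (k := k) (V := V) x]
    refine Finset.sum_eq_zero fun i _ => ?_
    have h : vertexSpace k X i = ⊥ := by
      by_contra h
      exact hempty ⟨i, h⟩
    exact (Submodule.mem_bot k).1 (h ▸ idem_smul_mem i x)
  obtain ⟨i, hi, hmin⟩ := hV.wellFounded.has_min _ hne
  obtain ⟨x, hx, hx0⟩ := Submodule.exists_mem_ne_zero_of_ne_bot hi
  refine hx0 ((Submodule.mem_bot (PathAlgebra k V)).1 (hbot ▸ mem_arrowSocle.2 ?_))
  intro l j a
  by_cases h : j = i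
  · subst h
    by_contra hne
    exact hmin l (fun h => hne ((Submodule.mem_bot k).1 (h ▸ arrow_smul_mem a x))) ⟨a⟩
  · rw [← arrow_smul_idem_smul, idem_smul_coe_ne h ⟨x, hx⟩, smul_zero]

theorem moduleSocle_eq_arrowSocle (hV : IsAcyclicQuiver V) :
    moduleSocle (PathAlgebra k V) X = arrowSocle k V X := by
  apply le_antisymm
  · refine sSup_le fun S (hS : IsSimpleModule (PathAlgebra k V) S) x hx => ?_
    have h : (⟨x, hx⟩ : S) ∈ arrowSocle k V S := by
      rw [arrowSocle_eq_top_of_isSimpleModule k V hV]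
      exact Submodule.mem_top
    exact fun i j a => congrArg Subtype.val (h i j a)
  · intro x hx
    rw [← sum_idem_smul (k := k) (V := V) x]
    refine Submodule.sum_mem _ fun i _ => ?_
    by_cases h0 : idem k i • x = 0
    · rw [h0]
      exact Submodule.zero_mem _
    · exact le_sSup (show Submodule.span (PathAlgebra k V) {idem k i • x} ∈
          {S : Submodule (PathAlgebra k V) X | IsSimpleModule (PathAlgebra k V) S} from
        isSimpleModule_span_of_mem_arrowSocle (Submodule.smul_mem _ _ hx) (idem_smul_mem i x) h0)
        (Submodule.mem_span_singleton_self _)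

end

variable [∀ i j : V, Fintype (i ⟶ j)]

section

variable (k V) (X : Type*) [AddCommGroup X] [Module k X] [Module (PathAlgebra k V) X]
  [IsScalarTower k (PathAlgebra k V) X]

/-- The submodule generated by the images of all arrows, described by its components. -/
def arrowRadical : Submodule (PathAlgebra k V) X where
  __ := (⨅ i : V, (LinearMap.range (sumArrows k X i)).comap (vertexProj k X i)).toAddSubmonoid
  smul_mem' r x hx := by
    classical
    refine smul_mem_of_arrow_smul_mem
      (⨅ i : V, (LinearMap.range (sumArrows k X i)).comap (vertexProj k X i)) ?_ ?_ r hx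
    · intro l y hy
      simp only [Submodule.mem_iInf, Submodule.mem_comap] at hy ⊢
      intro i
      by_cases h : i = l
      · subst h
        convert hy i using 1
        exact vertexProj_coe (vertexProj k X i y)
      · rw [show vertexProj k X i (idem k l • y) = 0 from
          Subtype.ext (idem_smul_coe_ne h (vertexProj k X l y))]
        exact Submodule.zero_mem _
    · intro l m a y hy
      simp only [Submodule.mem_iInf, Submodule.mem_comap]
      intro i
      by_cases h : i = l
      · subst h
        refine ⟨Pi.single ⟨m, a⟩ (vertexProj k X m y), Subtype.ext ?_⟩
        rw [sumArrows_single, coe_arrowMap, coe_vertexProj, coe_vertexProj, arrow_smul_idem_smul,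
          ← mul_smul, idem_mul_arrow]
      · rw [show vertexProj k X i (arrow k a • y) = 0 from
          Subtype.ext (idem_smul_coe_ne h ⟨_, arrow_smul_mem a y⟩)]
        exact Submodule.zero_mem _

variable {k V X} in
theorem mem_arrowRadical {x : X} :
    x ∈ arrowRadical k V X ↔ ∀ i : V, vertexProj k X i x ∈ LinearMap.range (sumArrows k X i) := by
  change x ∈ (⨅ i : V, (LinearMap.range (sumArrows k X i)).comap (vertexProj k X i)) ↔ _
  simp only [Submodule.mem_iInf, Submodule.mem_comap]

variable {k V X} in
theorem arrow_smul_mem_arrowRadical {i j : V} (a : i ⟶ j) (x : X) :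
    arrow k a • x ∈ arrowRadical k V X := by
  classical
  rw [mem_arrowRadical]
  intro l
  by_cases h : l = i
  · subst h
    refine ⟨Pi.single ⟨j, a⟩ (vertexProj k X j x), Subtype.ext ?_⟩
    rw [sumArrows_single, coe_arrowMap, coe_vertexProj, coe_vertexProj, arrow_smul_idem_smul,
      ← mul_smul, idem_mul_arrow]
  · rw [show vertexProj k X l (arrow k a • x) = 0 from
      Subtype.ext (idem_smul_coe_ne h ⟨_, arrow_smul_mem a x⟩)]
    exact Submodule.zero_mem _

theorem jacobson_eq_arrowRadical (hV : IsAcyclicQuiver V) :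
    Module.jacobson (PathAlgebra k V) X = arrowRadical k V X := by
  apply le_antisymm
  · apply Module.jacobson_le_of_eq_bot
    -- The quotient by the images of the arrows equals its socle, hence is semisimple.
    have htop : moduleSocle (PathAlgebra k V) (X ⧸ arrowRadical k V X) = ⊤ := by
      rw [moduleSocle_eq_arrowSocle k V _ hV, eq_top_iff]
      intro y _ i j a
      obtain ⟨x, rfl⟩ := Submodule.mkQ_surjective _ y
      rw [← map_smul]
      exact (Submodule.Quotient.mk_eq_zero _).2 (arrow_smul_mem_arrowRadical a x)
    have := IsSemisimpleModule.of_sSup_simples_eq_top htop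
    exact IsSemisimpleModule.jacobson_eq_bot _ _
  · refine le_sInf fun S hS x hx => ?_
    have : IsSimpleModule (PathAlgebra k V) (X ⧸ S) := isSimpleModule_iff_isCoatom.2 hS
    have hS' : ∀ (i j : V) (a : i ⟶ j) (y : X), arrow k a • y ∈ S := by
      intro i j a y
      have h : S.mkQ y ∈ arrowSocle k V (X ⧸ S) := by
        rw [arrowSocle_eq_top_of_isSimpleModule k V hV]
        exact Submodule.mem_top
      have h' := h i j a
      rw [← map_smul] at h'
      exact (Submodule.Quotient.mk_eq_zero _).1 h'
    rw [← sum_idem_smul (k := k) (V := V) x]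
    refine Submodule.sum_mem _ fun i _ => ?_
    obtain ⟨y, hy⟩ := mem_arrowRadical.1 hx i
    rw [← coe_vertexProj, ← hy, sumArrows_apply, Submodule.coe_sum]
    exact Submodule.sum_mem _ fun a _ => hS' _ _ a.2 _

/-- The dimension vector of the socle of a module which satisfies the surjectivity condition. -/
theorem socVec_eq (hV : IsAcyclicQuiver V) [Module.Finite k X] (hX : ArrowsSurjective k V X)
    (j : V) : socVec k X j = dimVec k X j - ∑ i : V, arrowCount i j * (dimVec k X i : ℤ) := by
  have h1 := (piArrows k X j).finrank_range_add_finrank_ker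
  rw [LinearMap.range_eq_top.2 (hX j), finrank_top, Module.finrank_pi_fintype,
    Fintype.sum_sigma] at h1
  have h2 : LinearMap.ker (piArrows k X j) =
      LinearMap.range (vertexMap (k := k) (V := V) (arrowSocle k V X).subtype j) := by
    ext x
    constructor
    · intro hx
      have hx' : (x : X) ∈ arrowSocle k V X := by
        intro i l a
        by_cases h : l = j
        · subst h
          exact congrArg Subtype.val (congrFun hx ⟨i, a⟩)
        · rw [← arrow_smul_idem_smul, idem_smul_coe_ne h, smul_zero]
      exact ⟨⟨⟨x, hx'⟩, mem_vertexSpace.2 (Subtype.ext (idem_smul_coe x))⟩, rfl⟩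
    · rintro ⟨y, rfl⟩
      exact funext fun a => Subtype.ext ((y : arrowSocle k V X).2 _ _ a.2)
  rw [h2, LinearMap.finrank_range_of_inj
    (vertexMap_injective (Submodule.subtype_injective _) j)] at h1
  rw [socVec, dimVec_congr (LinearEquiv.ofEq _ _ (moduleSocle_eq_arrowSocle k V X hV)),
    eq_sub_iff_add_eq']
  simp only [arrowCount]
  simp only [← dimVec_eq, Finset.sum_const, Finset.card_univ, smul_eq_mul] at h1
  exact_mod_cast h1

/-- The dimension vector of the top of a module which satisfies the injectivity condition. -/
theorem topVec_eq (hV : IsAcyclicQuiver V) [Module.Finite k X] (hX : ArrowsInjective k V X)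
    (i : V) : topVec k X i = dimVec k X i - ∑ j : V, arrowCount i j * (dimVec k X j : ℤ) := by
  have h1 := dimVec_submodule_add (arrowRadical k V X) i
  have h2 : LinearMap.range (sumArrows k X i) =
      LinearMap.range (vertexMap (k := k) (V := V) (arrowRadical k V X).subtype i) := by
    ext x
    constructor
    · intro hx
      have hx' : (x : X) ∈ arrowRadical k V X := by
        rw [mem_arrowRadical]
        intro l
        by_cases h : l = i
        · subst h
          rwa [vertexProj_coe]
        · rw [show vertexProj k X l (x : X) = 0 from Subtype.ext (idem_smul_coe_ne h x)]
          exact Submodule.zero_mem _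
      exact ⟨⟨⟨x, hx'⟩, mem_vertexSpace.2 (Subtype.ext (idem_smul_coe x))⟩, rfl⟩
    · rintro ⟨y, rfl⟩
      have h := mem_arrowRadical.1 (y : arrowRadical k V X).2 i
      convert h using 1
      exact Subtype.ext (congrArg Subtype.val (idem_smul_coe y)).symm
  have h3 := congrArg (fun W : Submodule k (vertexSpace k X i) => Module.finrank k W) h2
  rw [LinearMap.finrank_range_of_inj (hX i), LinearMap.finrank_range_of_inj
    (vertexMap_injective (Submodule.subtype_injective _) i), Module.finrank_pi_fintype,
    Fintype.sum_sigma] at h3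
  simp only [← dimVec_eq, Finset.sum_const, Finset.card_univ, smul_eq_mul] at h3
  rw [topVec, dimVec_congr (Submodule.quotEquivOfEq _ _ (jacobson_eq_arrowRadical k V X hV)), h1,
    ← h3]
  simp [arrowCount]

theorem topVec_nonneg (i : V) : 0 ≤ topVec k X i := Int.natCast_nonneg _

theorem socVec_nonneg (i : V) : 0 ≤ socVec k X i := Int.natCast_nonneg _

theorem topVec_of_subsingleton [Subsingleton X] : topVec k X = (0 : V → ℤ) :=
  funext fun i => congrArg Nat.cast (dimVec_eq_zero_of_subsingleton i)

end

variable {X Y : Type*} [AddCommGroup X] [Module k X] [Module (PathAlgebra k V) X]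
  [IsScalarTower k (PathAlgebra k V) X] [AddCommGroup Y] [Module k Y]
  [Module (PathAlgebra k V) Y] [IsScalarTower k (PathAlgebra k V) Y]
  [Module.Finite k X] [Module.Finite k Y]

theorem homDim_eq_sum_topVec (hV : IsAcyclicQuiver V) (hX : ArrowsInjective k V X) :
    (homDim k (PathAlgebra k V) X Y : ℤ) = ∑ i : V, topVec k X i * dimVec k Y i := by
  rw [homDim_eq_of_standardDiff_surjective (standardDiff_surjective_of_arrowsInjective hV hX)]
  simp only [topVec_eq k V X hV hX, sub_mul, Finset.sum_sub_distrib, Finset.sum_mul]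

theorem homDim_eq_sum_socVec (hV : IsAcyclicQuiver V) (hY : ArrowsSurjective k V Y) :
    (homDim k (PathAlgebra k V) X Y : ℤ) = ∑ i : V, socVec k Y i * dimVec k X i := by
  rw [homDim_eq_of_standardDiff_surjective (standardDiff_surjective_of_arrowsSurjective hV hY),
    Finset.sum_comm (f := fun i j : V => arrowCount i j * (dimVec k X j : ℤ) * dimVec k Y i)]
  simp only [socVec_eq k V Y hV hY, sub_mul, Finset.sum_sub_distrib, Finset.sum_mul]
  congr 1
  · exact Finset.sum_congr rfl fun i _ => mul_comm _ _
  · exact Finset.sum_congr rfl fun i _ => Finset.sum_congr rfl fun j _ => by ring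

instance finite_submodule (U : Submodule (PathAlgebra k V) X) : Module.Finite k U :=
  Module.Finite.of_injective (U.subtype.restrictScalars k) U.subtype_injective

theorem sum_socVec_nakayama_mul (hV : IsAcyclicQuiver V)
    [Module.Projective (PathAlgebra k V) X] :
    ∑ i : V, socVec k (Nakayama k (PathAlgebra k V) X) i * dimVec k Y i =
      ∑ i : V, topVec k X i * dimVec k Y i := by
  have : Module.Finite k (PathAlgebra k V) := PathAlgebra.finite hV
  have : Module.Finite (PathAlgebra k V) X := Module.Finite.of_restrictScalars_finite k _ X
  rw [← homDim_eq_sum_socVec hV (arrowsSurjective_nakayama X),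
    ← homDim_eq_sum_topVec hV (arrowsInjective_of_projective X), Nakayama.homDim_nakayama]

variable (X) in
/-- The socle of `ν(P)` and the top of `P` have the same dimension vector. Indeed, writing `s` and
`t` for these vectors, `∑ (t_i - s_i) u_i = [P, U] - [U, ν(P)] = 0` for all modules `U`, and this
applies to `U = P / rad P` and to `U = soc ν(P)`, so that `∑ (t_i - s_i)² = 0`. -/
theorem socVec_nakayama (hV : IsAcyclicQuiver V) [Module.Projective (PathAlgebra k V) X] :
    socVec k (Nakayama k (PathAlgebra k V) X) = (topVec k X : V → ℤ) := by
  have : Module.Finite k (PathAlgebra k V) := PathAlgebra.finite hV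
  have h1 : ∑ i : V, socVec k (Nakayama k (PathAlgebra k V) X) i * topVec k X i =
      ∑ i : V, topVec k X i * topVec k X i :=
    sum_socVec_nakayama_mul (Y := X ⧸ Module.jacobson (PathAlgebra k V) X) hV
  have h2 : ∑ i : V, socVec k (Nakayama k (PathAlgebra k V) X) i *
        socVec k (Nakayama k (PathAlgebra k V) X) i =
      ∑ i : V, topVec k X i * socVec k (Nakayama k (PathAlgebra k V) X) i :=
    sum_socVec_nakayama_mul
      (Y := moduleSocle (PathAlgebra k V) (Nakayama k (PathAlgebra k V) X)) hV
  have h3 : ∑ i : V, (topVec k X i - socVec k (Nakayama k (PathAlgebra k V) X) i) ^ 2 = 0 := by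
    have h4 : ∀ i : V, (topVec k X i - socVec k (Nakayama k (PathAlgebra k V) X) i) ^ 2 =
        (topVec k X i * topVec k X i - socVec k (Nakayama k (PathAlgebra k V) X) i * topVec k X i)
        - (topVec k X i * socVec k (Nakayama k (PathAlgebra k V) X) i -
          socVec k (Nakayama k (PathAlgebra k V) X) i *
            socVec k (Nakayama k (PathAlgebra k V) X) i) := fun i => by ring
    simp only [h4, Finset.sum_sub_distrib]
    rw [h1, h2, sub_self, sub_self, sub_self]
  funext i
  have h5 := (Finset.sum_eq_zero_iff_of_nonneg fun i _ => sq_nonneg _).1 h3 i (Finset.mem_univ i)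
  exact (sub_eq_zero.1 (pow_eq_zero_iff two_ne_zero |>.1 h5)).symm

end SocleRadical

/-! ### The matrices of the ice quiver and the Euler form -/

section Lattice

variable {V : Type*} [Fintype V] [DecidableEq V] [Quiver V] [∀ i j : V, Fintype (i ⟶ j)]
  {N : Finset V}

theorem sum_principal_eq_sum {f : V → ℤ} (hf : ∀ i, i ∉ N → f i = 0) :
    ∑ i : N, f i = ∑ i, f i := by
  rw [Finset.sum_coe_sort]
  exact Finset.sum_subset (Finset.subset_univ N) fun i _ hi => hf i hi

theorem matI_mulVec {u : V → ℤ} (hu : ∀ i, i ∉ N → u i = 0) (i : V) :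
    (matI N *ᵥ fun j : N => u j) i = u i :=
  (sum_principal_eq_sum (f := fun j => (if i = j then 1 else 0) * u j)
    fun j hj => by simp [hu j hj]).trans (by simp)

theorem matR_mulVec {u : V → ℤ} (hu : ∀ i, i ∉ N → u i = 0) (i : V) :
    (matR N *ᵥ fun j : N => u j) i = ∑ j, arrowCount j i * u j :=
  sum_principal_eq_sum (f := fun j => arrowCount j i * u j) fun j hj => by simp [hu j hj]

theorem matB_mulVec {u : V → ℤ} (hu : ∀ i, i ∉ N → u i = 0) (i : V) :
    (matB N *ᵥ fun j : N => u j) i =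
      ∑ j, arrowCount i j * u j - ∑ j, arrowCount j i * u j := by
  rw [mulVec, dotProduct, ← Finset.sum_sub_distrib, ← sum_principal_eq_sum (N := N)]
  · exact Finset.sum_congr rfl fun j _ => sub_mul _ _ _
  · intro j hj
    simp [hu j hj]

theorem eulerForm_eq {u x : V → ℤ} (hu : ∀ i, i ∉ N → u i = 0) (hx : ∀ i, i ∉ N → x i = 0) :
    eulerForm N (fun i => u i) (fun i => x i) =
      ∑ i, u i * x i - ∑ i, ∑ j, u i * arrowCount j i * x j := by
  rw [eulerForm, ← sum_principal_eq_sum (N := N), ← sum_principal_eq_sum (N := N)]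
  · congr 1
    refine Finset.sum_congr rfl fun i _ => ?_
    rw [← sum_principal_eq_sum (N := N)]
    · rfl
    · intro j hj
      simp [hx j hj]
  · intro i hi
    simp [hu i hi]
  · intro i hi
    simp [hu i hi]

theorem eulerForm_eq_sum_left {u x : V → ℤ} (hu : ∀ i, i ∉ N → u i = 0)
    (hx : ∀ i, i ∉ N → x i = 0) :
    eulerForm N (fun i => u i) (fun i => x i) =
      ∑ i, u i * (x i - ∑ j, arrowCount j i * x j) := by
  rw [eulerForm_eq hu hx, ← Finset.sum_sub_distrib]
  simp only [mul_sub, Finset.mul_sum, mul_assoc]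

theorem eulerForm_eq_sum_right {u x : V → ℤ} (hu : ∀ i, i ∉ N → u i = 0)
    (hx : ∀ i, i ∉ N → x i = 0) :
    eulerForm N (fun i => u i) (fun i => x i) =
      ∑ i, x i * (u i - ∑ j, arrowCount i j * u j) := by
  rw [eulerForm_eq hu hx, Finset.sum_comm, ← Finset.sum_sub_distrib]
  refine Finset.sum_congr rfl fun i _ => ?_
  rw [mul_sub, Finset.mul_sum, mul_comm]
  congr 1
  exact Finset.sum_congr rfl fun j _ => by ring

theorem eulerForm_add_right (N : Finset V) (e x y : N → ℤ) :
    eulerForm N e (x + y) = eulerForm N e x + eulerForm N e y := by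
  simp only [eulerForm, Pi.add_apply, mul_add, Finset.sum_add_distrib]
  ring

theorem eulerForm_add_left (N : Finset V) (e x y : N → ℤ) :
    eulerForm N (x + y) e = eulerForm N x e + eulerForm N y e := by
  simp only [eulerForm, Pi.add_apply, add_mul, Finset.sum_add_distrib]
  ring

theorem latticeForm_add_right {V : Type*} [Fintype V] (Λ : Matrix V V ℤ) (e x y : V → ℤ) :
    latticeForm Λ e (x + y) = latticeForm Λ e x + latticeForm Λ e y := by
  simp [latticeForm, mulVec_add, dotProduct_add]

/-- The compatibility of `Λ` and `B̃`. -/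
theorem latticeForm_matB_mulVec {Λ : Matrix V V ℤ} (hcomp : Λ * (-matB N) = matI N)
    (t : V → ℤ) {u : V → ℤ} (hu : ∀ i, i ∉ N → u i = 0) :
    latticeForm Λ t (matB N *ᵥ fun i => u i) = -∑ i, t i * u i := by
  have h : Λ * matB N = -matI N := by rw [← hcomp, Matrix.mul_neg, neg_neg]
  rw [latticeForm, mulVec_mulVec, h, neg_mulVec, dotProduct_neg]
  congr 1
  exact Finset.sum_congr rfl fun i _ => by rw [matI_mulVec hu]

end Lattice

/-! ### The Caldero-Chapoton sum as a sum over submodules -/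

section CCSum

variable {k V : Type*} [Field k] [Finite k] [Fintype V] [DecidableEq V] [Quiver V]
  [∀ i j : V, Fintype (i ⟶ j)]

variable (N : Finset V) (Λ : Matrix V V ℤ)

variable (k) in
/-- The contribution `q^{-⟨e, m - e⟩/2} X^{B̃ e - (Ĩ - R̃) m + t}` of a submodule of dimension
vector `e` of a module of dimension vector `m` to the sum `X_{M,t}`. -/
def ccTerm (e m : N → ℤ) (t : V → ℤ) : Torus k Λ :=
  qHalfPow k (-eulerForm N e (m - e)) •
    QuantumTorus.X (qHalf k) Λ (matB N *ᵥ e - (matI N - matR N) *ᵥ m + t)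

variable {N}

theorem X_mul_ccTerm (e m : N → ℤ) (t : V → ℤ) :
    QuantumTorus.X (qHalf k) Λ t * ccTerm k N Λ e m 0 =
      qHalfPow k (latticeForm Λ t (matB N *ᵥ e) +
        latticeForm Λ t (-((matI N - matR N) *ᵥ m))) • ccTerm k N Λ e m t := by
  rw [ccTerm, ccTerm, QuantumTorus.mul_smul', QuantumTorus.X_mul_X, smul_comm, add_zero,
    ← latticeForm_add_right, ← sub_eq_add_neg, add_comm t]
  rfl

/-- Case of a submodule of `M` which lies in `B ⊆ M`, where `b` is the dimension vector of `B`: its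
contributions to `X_{M,t}` and `X_{B,s}` agree. -/
theorem ccTerm_eq_of_sub {e m b : N → ℤ} {t s : V → ℤ}
    (h : (matI N - matR N) *ᵥ (m - b) = t - s) (he : eulerForm N e (m - b) = 0) :
    ccTerm k N Λ e m t = ccTerm k N Λ e b s := by
  have h1 : eulerForm N e (m - e) = eulerForm N e (b - e) := by
    rw [show m - e = (m - b) + (b - e) by abel, eulerForm_add_right, he, zero_add]
  rw [mulVec_sub] at h
  rw [ccTerm, ccTerm, h1]
  congr 2
  rw [show t = (matI N - matR N) *ᵥ m - (matI N - matR N) *ᵥ b + s by rw [h]; abel]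
  abel

/-- Case of a submodule of `M` which contains `D ⊆ M`, where `d` and `a` are the dimension vectors
of `D` and `M / D`: its contribution to `X_{M,t}` is that of its image to `X_{M/D,s}`. -/
theorem ccTerm_eq_of_quotient {e d a : N → ℤ} {t s : V → ℤ}
    (h : (matI N - matR N - matB N) *ᵥ d = t - s) (he : eulerForm N d (a - e) = 0) :
    ccTerm k N Λ (d + e) (d + a) t = ccTerm k N Λ e a s := by
  have h1 : eulerForm N (d + e) (d + a - (d + e)) = eulerForm N e (a - e) := by
    rw [add_sub_add_left_eq_sub, eulerForm_add_left, he, zero_add]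
  rw [sub_mulVec] at h
  rw [ccTerm, ccTerm, h1, mulVec_add, mulVec_add]
  congr 2
  rw [show t = (matI N - matR N) *ᵥ d - matB N *ᵥ d + s by rw [h]; abel]
  abel

variable (N) (M : Type*) [AddCommGroup M] [Module k M] [Module (PathAlgebra k V) M]
  [IsScalarTower k (PathAlgebra k V) M]

variable (k) in
/-- The dimension vector of a module, as an integer vector indexed by the principal part. -/
def principalVec : N → ℤ := fun i => (dimVec k M (i : V) : ℤ)

theorem ccSum_eq_sum [Module.Finite k M] [Fintype (Submodule (PathAlgebra k V) M)] (t : V → ℤ) :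
    ccSum N k Λ M t =
      ∑ U : Submodule (PathAlgebra k V) M,
        ccTerm k N Λ (principalVec k N U) (principalVec k N M) t := by
  classical
  have hmap : ∀ U ∈ (Finset.univ : Finset (Submodule (PathAlgebra k V) M)),
      principalDim N k U ∈ Finset.Icc 0 (principalDim N k M) := fun U _ =>
    Finset.mem_Icc.2 ⟨fun i => Nat.zero_le _,
      fun i => dimVec_le_of_injective U.subtype_injective i⟩
  rw [← Finset.sum_fiberwise_of_maps_to hmap, ccSum]
  refine Finset.sum_congr rfl fun e _ => ?_
  have hterm : ∀ U ∈ Finset.univ.filter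
      (fun U : Submodule (PathAlgebra k V) M => principalDim N k U = e),
      ccTerm k N Λ (principalVec k N U) (principalVec k N M) t =
        ccTerm k N Λ (fun i => (e i : ℤ)) (principalVec k N M) t := by
    intro U hU
    rw [← (Finset.mem_filter.1 hU).2]
    rfl
  have hcard : Nat.card (QuiverGrassmannian N k M e) = (Finset.univ.filter
      (fun U : Submodule (PathAlgebra k V) M => principalDim N k U = e)).card := by
    rw [QuiverGrassmannian, Nat.card_eq_fintype_card, Fintype.card_subtype]
  rw [Finset.sum_congr rfl hterm, Finset.sum_const, ← hcard, mul_smul,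
    Nat.cast_smul_eq_nsmul (HalfPowerRing k)]
  rfl

theorem finite_submodules [Module.Finite k M] : Finite (Submodule (PathAlgebra k V) M) := by
  have : Finite M := Module.finite_of_finite k
  exact Finite.of_injective _ (SetLike.coe_injective (A := Submodule (PathAlgebra k V) M))

theorem ccTau_eq (P : Type*) [AddCommGroup P] [Module k P] [Module (PathAlgebra k V) P]
    [IsScalarTower k (PathAlgebra k V) P] :
    ccTau N k Λ P = QuantumTorus.X (qHalf k) Λ (topVec k P) := by
  have : Fintype (Submodule (PathAlgebra k V) PUnit.{1}) := Fintype.ofSubsingleton ⊥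
  have h : ∀ U : Submodule (PathAlgebra k V) PUnit.{1}, principalVec k N U = 0 := fun U =>
    funext fun i => congrArg Nat.cast (dimVec_eq_zero_of_subsingleton _)
  have h' : principalVec k N PUnit.{1} = 0 :=
    funext fun i => congrArg Nat.cast (dimVec_eq_zero_of_subsingleton _)
  rw [ccTau, ccShiftProj, ccSum_eq_sum, Fintype.sum_subsingleton _ ⊥, h, h', ccTerm]
  simp [eulerForm, qHalfPow]

theorem ccModule_eq : ccModule N k Λ M = ccSum N k Λ M 0 := by
  rw [ccModule, ccShiftProj, topVec_of_subsingleton]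

end CCSum

/-! ### Submodules of a module with a one-dimensional space of maps from a projective module -/

section Dichotomy

variable {k V : Type*} [Field k] [Fintype V] [DecidableEq V] [Quiver V]
  [∀ i j : V, Fintype (i ⟶ j)]

theorem eq_zero_of_homDim_eq_zero {k A X Y : Type*} [Field k] [Ring A] [Algebra k A]
    [AddCommGroup X] [Module k X] [Module A X] [IsScalarTower k A X] [AddCommGroup Y] [Module k Y]
    [Module A Y] [IsScalarTower k A Y] [Module.Finite k X] [Module.Finite k Y]
    (h : homDim k A X Y = 0) (φ : X →ₗ[A] Y) : φ = 0 := by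
  have := finite_hom k A X Y
  have := Module.finrank_zero_iff.1 h
  exact Subsingleton.elim _ _

variable {X Y M P : Type*} [AddCommGroup X] [Module k X] [Module (PathAlgebra k V) X]
  [IsScalarTower k (PathAlgebra k V) X] [AddCommGroup Y] [Module k Y]
  [Module (PathAlgebra k V) Y] [IsScalarTower k (PathAlgebra k V) Y]
  [AddCommGroup M] [Module k M] [Module (PathAlgebra k V) M]
  [IsScalarTower k (PathAlgebra k V) M] [Module.Finite k M]
  [AddCommGroup P] [Module k P] [Module (PathAlgebra k V) P]
  [IsScalarTower k (PathAlgebra k V) P] [Module.Finite k P] [Module.Projective (PathAlgebra k V) P]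

theorem IsPrincipalModule.of_injective {N : Finset V} (hY : IsPrincipalModule N k Y)
    {φ : X →ₗ[PathAlgebra k V] Y} (hφ : Function.Injective φ) : IsPrincipalModule N k X :=
  fun i hi x => hφ (by rw [map_smul, hY i hi, map_zero])

theorem IsPrincipalModule.of_surjective {N : Finset V} (hX : IsPrincipalModule N k X)
    {φ : X →ₗ[PathAlgebra k V] Y} (hφ : Function.Surjective φ) : IsPrincipalModule N k Y := by
  intro i hi y
  obtain ⟨x, rfl⟩ := hφ y
  rw [← map_smul, hX i hi, map_zero]

theorem IsPrincipalModule.dimVec_eq_zero {N : Finset V} (hX : IsPrincipalModule N k X) (i : V)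
    (hi : i ∉ N) : (dimVec k X i : ℤ) = 0 := by
  have : Subsingleton (vertexSpace k X i) := ⟨fun x y => Subtype.ext (by
    rw [← idem_smul_coe x, ← idem_smul_coe y, hX i hi, hX i hi])⟩
  rw [dimVec_eq, Module.finrank_zero_of_subsingleton, Nat.cast_zero]

theorem sum_mul_eq_zero_of_le {t u w : V → ℤ} (ht : ∀ i, 0 ≤ t i) (hu : ∀ i, 0 ≤ u i)
    (huw : ∀ i, u i ≤ w i) (h : ∑ i, t i * w i = 0) : ∑ i, t i * u i = 0 :=
  le_antisymm (h ▸ Finset.sum_le_sum fun i _ => mul_le_mul_of_nonneg_left (huw i) (ht i))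
    (Finset.sum_nonneg fun i _ => mul_nonneg (ht i) (hu i))

theorem homDim_projective (hV : IsAcyclicQuiver V) [Module.Finite k Y] :
    (homDim k (PathAlgebra k V) P Y : ℤ) = ∑ i : V, topVec k P i * dimVec k Y i :=
  homDim_eq_sum_topVec hV (arrowsInjective_of_projective P)

theorem homDim_to_nakayama (hV : IsAcyclicQuiver V) [Module.Finite k X] :
    (homDim k (PathAlgebra k V) X (Nakayama k (PathAlgebra k V) P) : ℤ) =
      ∑ i : V, topVec k P i * dimVec k X i := by
  have : Module.Finite (PathAlgebra k V) P := Module.Finite.of_restrictScalars_finite k _ P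
  rw [Nakayama.homDim_nakayama, homDim_projective hV]

theorem sum_topVec_add (U : Submodule (PathAlgebra k V) M) :
    ∑ i : V, topVec k P i * dimVec k M i =
      ∑ i : V, topVec k P i * dimVec k U i + ∑ i : V, topVec k P i * dimVec k (M ⧸ U) i := by
  rw [← Finset.sum_add_distrib]
  refine Finset.sum_congr rfl fun i _ => ?_
  rw [dimVec_submodule_add U i, Nat.cast_add, mul_add]

theorem sum_topVec_nonneg (X : Type*) [AddCommGroup X] [Module k X] [Module (PathAlgebra k V) X]
    [IsScalarTower k (PathAlgebra k V) X] : 0 ≤ ∑ i : V, topVec k P i * (dimVec k X i : ℤ) :=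
  Finset.sum_nonneg fun i _ => mul_nonneg (topVec_nonneg k V P i) (Int.natCast_nonneg _)

theorem sum_topVec_mono {U W : Submodule (PathAlgebra k V) M} (h : U ≤ W) :
    ∑ i : V, topVec k P i * (dimVec k U i : ℤ) ≤ ∑ i : V, topVec k P i * (dimVec k W i : ℤ) :=
  Finset.sum_le_sum fun i _ => mul_le_mul_of_nonneg_left
    (Int.ofNat_le.2 (dimVec_le_of_injective (Submodule.inclusion_injective h) i))
    (topVec_nonneg k V P i)

/-- If `[P, M] = 1` and `g : M → ν(P)` is nonzero then `[P, U] = 0` for submodules of `ker g`: the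
image of `g` has a nonzero map to `ν(P)`, and therefore accounts for all of `[P, M]`. -/
theorem sum_topVec_of_le_ker (hV : IsAcyclicQuiver V)
    (hPM : homDim k (PathAlgebra k V) P M = 1)
    {g : M →ₗ[PathAlgebra k V] Nakayama k (PathAlgebra k V) P} (hg : g ≠ 0)
    {U : Submodule (PathAlgebra k V) M} (hU : U ≤ LinearMap.ker g) :
    ∑ i : V, topVec k P i * (dimVec k U i : ℤ) = 0 := by
  have : Module.Finite k (PathAlgebra k V) := PathAlgebra.finite hV
  have h1 := homDim_projective (k := k) (P := P) (Y := M) hV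
  have h2 : ∑ i : V, topVec k P i * (dimVec k M i : ℤ) =
      ∑ i : V, topVec k P i * (dimVec k (LinearMap.ker g) i : ℤ) +
        ∑ i : V, topVec k P i * (dimVec k (LinearMap.range g) i : ℤ) := by
    rw [← Finset.sum_add_distrib]
    refine Finset.sum_congr rfl fun i _ => ?_
    rw [dimVec_ker_add_range g i, Nat.cast_add, mul_add]
  have h3 : homDim k (PathAlgebra k V) (LinearMap.range g)
      (Nakayama k (PathAlgebra k V) P) ≠ 0 := by
    intro h0
    refine hg (LinearMap.range_eq_bot.1 ((Submodule.eq_bot_iff _).2 fun x hx => ?_))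
    exact LinearMap.congr_fun (eq_zero_of_homDim_eq_zero h0 (LinearMap.range g).subtype) ⟨x, hx⟩
  have h4 := homDim_to_nakayama (k := k) (P := P) (X := LinearMap.range g) hV
  have h5 := sum_topVec_mono (k := k) (P := P) hU
  have h6 := sum_topVec_nonneg (k := k) (V := V) (P := P) U
  lia

/-- If `[P, M] = 1` and `f : P → M` is nonzero then the image of `f` already accounts for all of
`[P, M]`. -/
theorem sum_topVec_of_range_le (hV : IsAcyclicQuiver V)
    (hPM : homDim k (PathAlgebra k V) P M = 1) {f : P →ₗ[PathAlgebra k V] M} (hf : f ≠ 0)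
    {U : Submodule (PathAlgebra k V) M} (hU : LinearMap.range f ≤ U) :
    ∑ i : V, topVec k P i * (dimVec k U i : ℤ) = 1 ∧
      ∑ i : V, topVec k P i * (dimVec k (M ⧸ U) i : ℤ) = 0 := by
  have h1 := homDim_projective (k := k) (P := P) (Y := M) hV
  have h2 := sum_topVec_add (k := k) (P := P) U
  have h3 : homDim k (PathAlgebra k V) P (LinearMap.range f) ≠ 0 := by
    intro h0
    refine hf (LinearMap.ext fun x => ?_)
    exact congrArg Subtype.val
      (LinearMap.congr_fun (eq_zero_of_homDim_eq_zero h0 f.rangeRestrict) x)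
  have h4 := homDim_projective (k := k) (P := P) (Y := LinearMap.range f) hV
  have h5 := sum_topVec_mono (k := k) (P := P) hU
  have h6 := sum_topVec_nonneg (k := k) (V := V) (P := P) (M ⧸ U)
  constructor <;> lia

/-- If `[P, M] = 1`, and hence `[M, ν(P)] = 1`, then a submodule of `M` either lies in the
kernel of a given nonzero map `M → ν(P)` or contains the image of a given nonzero map `P → M`, and
not both. -/
theorem not_le_ker_iff_range_le (hV : IsAcyclicQuiver V)
    (hPM : homDim k (PathAlgebra k V) P M = 1)
    {f : P →ₗ[PathAlgebra k V] M} (hf : f ≠ 0)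
    {g : M →ₗ[PathAlgebra k V] Nakayama k (PathAlgebra k V) P} (hg : g ≠ 0)
    (U : Submodule (PathAlgebra k V) M) : ¬ U ≤ LinearMap.ker g ↔ LinearMap.range f ≤ U := by
  have : Module.Finite k (PathAlgebra k V) := PathAlgebra.finite hV
  constructor
  · intro hU
    have h1 := homDim_projective (k := k) (P := P) (Y := M) hV
    have h2 := sum_topVec_add (k := k) (P := P) U
    have h3 : homDim k (PathAlgebra k V) U (Nakayama k (PathAlgebra k V) P) ≠ 0 := by
      intro h0
      exact hU fun x hx =>
        LinearMap.congr_fun (eq_zero_of_homDim_eq_zero h0 (g ∘ₗ U.subtype)) ⟨x, hx⟩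
    have h4 := homDim_to_nakayama (k := k) (P := P) (X := U) hV
    have h5 := homDim_projective (k := k) (P := P) (Y := M ⧸ U) hV
    have h6 := eq_zero_of_homDim_eq_zero (show homDim k (PathAlgebra k V) P (M ⧸ U) = 0 by lia)
      (U.mkQ ∘ₗ f)
    rintro _ ⟨x, rfl⟩
    exact (Submodule.Quotient.mk_eq_zero _).1 (LinearMap.congr_fun h6 x)
  · intro h1 h2
    have h3 := (sum_topVec_of_range_le hV hPM hf h1).1
    have h4 := sum_topVec_of_le_ker hV hPM hg h2
    lia

end Dichotomy

/-! ### The multiplication formula -/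

section Multiplication

variable {k V : Type*} [Field k] [Fintype V] [DecidableEq V] [Quiver V]
  [∀ i j : V, Fintype (i ⟶ j)] {N : Finset V} {M P : Type*}
  [AddCommGroup M] [Module k M] [Module (PathAlgebra k V) M]
  [IsScalarTower k (PathAlgebra k V) M] [Module.Finite k M]
  [AddCommGroup P] [Module k P] [Module (PathAlgebra k V) P]
  [IsScalarTower k (PathAlgebra k V) P] [Module.Finite k P] [Module.Projective (PathAlgebra k V) P]

/-- The kernel of a map from a projective module is a submodule of a projective module. -/
theorem arrowsInjective_ker (f : P →ₗ[PathAlgebra k V] M) :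
    ArrowsInjective k V (LinearMap.ker f) :=
  (arrowsInjective_of_projective P).of_injective (Submodule.subtype_injective _)

/-- The cokernel of a map to `ν(P)` is a quotient of `ν(P)`. -/
theorem arrowsSurjective_coker (g : M →ₗ[PathAlgebra k V] Nakayama k (PathAlgebra k V) P) :
    ArrowsSurjective k V (Nakayama k (PathAlgebra k V) P ⧸ LinearMap.range g) :=
  (arrowsSurjective_nakayama P).of_surjective (Submodule.mkQ_surjective _)

/-- For `L = im g ⊆ ν(P)`, the Euler characteristic `⟨S_i, L⟩` is computed by the injective
resolution `0 → L → ν(P) → coker g → 0`. -/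
theorem dimVec_range_sub (hV : IsAcyclicQuiver V)
    (g : M →ₗ[PathAlgebra k V] Nakayama k (PathAlgebra k V) P) (i : V) :
    (dimVec k (LinearMap.range g) i : ℤ) -
        ∑ j, arrowCount j i * (dimVec k (LinearMap.range g) j : ℤ) =
      topVec k P i - socVec k (Nakayama k (PathAlgebra k V) P ⧸ LinearMap.range g) i := by
  have : Module.Finite k (PathAlgebra k V) := PathAlgebra.finite hV
  rw [← socVec_nakayama P hV, socVec_eq k V _ hV (arrowsSurjective_nakayama P),
    socVec_eq k V _ hV (arrowsSurjective_coker g)]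
  simp only [dimVec_submodule_add (k := k) (LinearMap.range g), Nat.cast_add, mul_add,
    Finset.sum_add_distrib]
  ring

/-- For `D = im f`, the Euler characteristic `⟨D, S_i⟩` is computed by the projective resolution
`0 → ker f → P → D → 0`. -/
theorem dimVec_range_sub' (hV : IsAcyclicQuiver V) (f : P →ₗ[PathAlgebra k V] M) (i : V) :
    (dimVec k (LinearMap.range f) i : ℤ) -
        ∑ j, arrowCount i j * (dimVec k (LinearMap.range f) j : ℤ) =
      topVec k P i - topVec k (LinearMap.ker f) i := by
  rw [topVec_eq k V _ hV (arrowsInjective_of_projective P),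
    topVec_eq k V _ hV (arrowsInjective_ker f)]
  simp only [dimVec_ker_add_range (k := k) f, Nat.cast_add, mul_add,
    Finset.sum_add_distrib]
  ring

variable [Finite k] (Λ : Matrix V V ℤ)

/-- A submodule of `B = ker g` contributes equally to `X_{M,t}` and to the sum for `B ⊕ I'[-1]`. -/
theorem ccTerm_of_le_ker (hV : IsAcyclicQuiver V) (hM : IsPrincipalModule N k M)
    (hPM : homDim k (PathAlgebra k V) P M = 1)
    (g : M →ₗ[PathAlgebra k V] Nakayama k (PathAlgebra k V) P) (hg : g ≠ 0)
    (hBI : homDim k (PathAlgebra k V) (LinearMap.ker g)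
      (Nakayama k (PathAlgebra k V) P ⧸ LinearMap.range g) = 0)
    {U : Submodule (PathAlgebra k V) M} (hU : U ≤ LinearMap.ker g) :
    ccTerm k N Λ (principalVec k N U) (principalVec k N M) (topVec k P) =
      ccTerm k N Λ (principalVec k N U) (principalVec k N (LinearMap.ker g))
        (socVec k (Nakayama k (PathAlgebra k V) P ⧸ LinearMap.range g)) := by
  have : Module.Finite k (PathAlgebra k V) := PathAlgebra.finite hV
  have hL : IsPrincipalModule N k (LinearMap.range g) :=
    hM.of_surjective g.surjective_rangeRestrict
  have hl : principalVec k N M - principalVec k N (LinearMap.ker g) =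
      fun i : N => (dimVec k (LinearMap.range g) (i : V) : ℤ) := by
    funext i
    simp only [Pi.sub_apply, principalVec, dimVec_ker_add_range (k := k) g (i : V), Nat.cast_add]
    ring
  have hUp : IsPrincipalModule N k U := hM.of_injective U.subtype_injective
  apply ccTerm_eq_of_sub
  · funext i
    rw [hl, sub_mulVec, Pi.sub_apply, matI_mulVec hL.dimVec_eq_zero,
      matR_mulVec hL.dimVec_eq_zero, dimVec_range_sub hV, Pi.sub_apply]
  · have h1 := sum_topVec_of_le_ker hV hPM hg hU
    have h2 : ∑ i : V, socVec k (Nakayama k (PathAlgebra k V) P ⧸ LinearMap.range g) i *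
        (dimVec k U i : ℤ) = 0 := by
      refine sum_mul_eq_zero_of_le (socVec_nonneg k V _) (fun i => Int.natCast_nonneg _)
        (fun i => Int.ofNat_le.2 (dimVec_le_of_injective (Submodule.inclusion_injective hU) i)) ?_
      rw [← homDim_eq_sum_socVec hV (arrowsSurjective_coker g), hBI, Nat.cast_zero]
    -- `⟨U, im g⟩ = [U, ν(P)] - [U, coker g]`, and both terms vanish.
    rw [hl]
    refine (eulerForm_eq_sum_left hUp.dimVec_eq_zero hL.dimVec_eq_zero).trans ?_
    simp only [dimVec_range_sub hV, mul_comm (dimVec k U _ : ℤ)]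
    simp only [sub_mul, Finset.sum_sub_distrib]
    rw [h1, h2, sub_zero]

theorem dimVec_comap_mkQ (D : Submodule (PathAlgebra k V) M)
    (W : Submodule (PathAlgebra k V) (M ⧸ D)) (i : V) :
    dimVec k (W.comap D.mkQ) i = dimVec k D i + dimVec k W i := by
  have hD : D ≤ W.comap D.mkQ := Submodule.le_comap_mkQ D W
  refine dimVec_add_of_exact (φ := Submodule.inclusion hD)
    (ψ := D.mkQ.restrict (p := W.comap D.mkQ) (q := W) fun x hx => hx)
    (Submodule.inclusion_injective hD) ?_ ?_ i
  · rintro ⟨y, hy⟩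
    obtain ⟨x, rfl⟩ := D.mkQ_surjective y
    exact ⟨⟨x, hy⟩, rfl⟩
  · rintro ⟨x, hx⟩
    rw [Subtype.ext_iff]
    refine (Submodule.Quotient.mk_eq_zero D).trans ⟨fun h => ⟨⟨x, h⟩, rfl⟩, ?_⟩
    rintro ⟨y, hy⟩
    have h : (y : M) = x := congrArg Subtype.val hy
    change x ∈ D
    exact h ▸ y.2

/-- A submodule of `A = coker f` contributes to the sum for `A ⊕ P'[1]` what its preimage in `M`
contributes to `X_{M,t}`. -/
theorem ccTerm_comap_mkQ (hV : IsAcyclicQuiver V) (hM : IsPrincipalModule N k M)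
    (hPM : homDim k (PathAlgebra k V) P M = 1) (f : P →ₗ[PathAlgebra k V] M) (hf : f ≠ 0)
    (hPA : homDim k (PathAlgebra k V) (LinearMap.ker f) (M ⧸ LinearMap.range f) = 0)
    (W : Submodule (PathAlgebra k V) (M ⧸ LinearMap.range f)) :
    ccTerm k N Λ (principalVec k N (W.comap (LinearMap.range f).mkQ)) (principalVec k N M)
        (topVec k P) =
      ccTerm k N Λ (principalVec k N W) (principalVec k N (M ⧸ LinearMap.range f))
        (topVec k (LinearMap.ker f)) := by
  have hD : IsPrincipalModule N k (LinearMap.range f) :=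
    hM.of_injective (Submodule.subtype_injective _)
  have hA : IsPrincipalModule N k (M ⧸ LinearMap.range f) :=
    hM.of_surjective (Submodule.mkQ_surjective _)
  have hAW : IsPrincipalModule N k ((M ⧸ LinearMap.range f) ⧸ W) :=
    hA.of_surjective (Submodule.mkQ_surjective _)
  have hU : principalVec k N (W.comap (LinearMap.range f).mkQ) =
      (fun i : N => (dimVec k (LinearMap.range f) (i : V) : ℤ)) + principalVec k N W :=
    funext fun i => by simp [principalVec, dimVec_comap_mkQ]
  have hMv : principalVec k N M = (fun i : N => (dimVec k (LinearMap.range f) (i : V) : ℤ)) +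
      principalVec k N (M ⧸ LinearMap.range f) :=
    funext fun i => by
      simp [principalVec, dimVec_submodule_add (k := k) (LinearMap.range f) (i : V)]
  have hsub : principalVec k N (M ⧸ LinearMap.range f) - principalVec k N W =
      fun i : N => (dimVec k ((M ⧸ LinearMap.range f) ⧸ W) (i : V) : ℤ) :=
    funext fun i => by simp [principalVec, dimVec_submodule_add (k := k) W (i : V)]
  rw [hU, hMv]
  apply ccTerm_eq_of_quotient
  · funext i
    rw [sub_mulVec, sub_mulVec, Pi.sub_apply, Pi.sub_apply, matI_mulVec hD.dimVec_eq_zero,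
      matR_mulVec hD.dimVec_eq_zero, matB_mulVec hD.dimVec_eq_zero, Pi.sub_apply,
      ← dimVec_range_sub' hV]
    ring
  · have hle : ∀ i, (dimVec k ((M ⧸ LinearMap.range f) ⧸ W) i : ℤ) ≤
        dimVec k (M ⧸ LinearMap.range f) i := fun i =>
      Int.ofNat_le.2 ((dimVec_submodule_add (k := k) W i).symm ▸ Nat.le_add_left _ _)
    have h1 := sum_mul_eq_zero_of_le (topVec_nonneg k V P) (fun i => Int.natCast_nonneg _) hle
      (sum_topVec_of_range_le hV hPM hf le_rfl).2
    have h2 := sum_mul_eq_zero_of_le (topVec_nonneg k V (LinearMap.ker f))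
      (fun i => Int.natCast_nonneg _) hle (by
        rw [← homDim_eq_sum_topVec hV (arrowsInjective_ker f), hPA, Nat.cast_zero])
    -- `⟨im f, M / U⟩ = [P, M / U] - [ker f, M / U]`, and both terms vanish.
    rw [hsub]
    refine (eulerForm_eq_sum_right hD.dimVec_eq_zero hAW.dimVec_eq_zero).trans ?_
    simp only [dimVec_range_sub' hV,
      mul_comm (dimVec k ((M ⧸ LinearMap.range f) ⧸ W) _ : ℤ)]
    simp only [sub_mul, Finset.sum_sub_distrib]
    rw [h1, h2, sub_zero]

end Multiplication

end

theorem mainTheorem3 {k : Type*} [Field k] [Finite k]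
    {V : Type*} [Fintype V] [DecidableEq V] [Quiver V] [∀ i j : V, Fintype (i ⟶ j)]
    (hV : IsAcyclicQuiver V) (N : Finset V)
    (Λ : Matrix V V ℤ) (hΛ : Λ.transpose = -Λ) (hcomp : Λ * (-matB N) = matI N)
    {M : Type*} [AddCommGroup M] [Module k M] [Module (PathAlgebra k V) M]
    [IsScalarTower k (PathAlgebra k V) M] [Module.Finite k M]
    (hM : IsPrincipalModule N k M)
    {P : Type*} [AddCommGroup P] [Module k P] [Module (PathAlgebra k V) P]
    [IsScalarTower k (PathAlgebra k V) P] [Module.Finite k P]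
    [Module.Projective (PathAlgebra k V) P]
    (hPM : homDim k (PathAlgebra k V) P M = 1)
    (hMI : homDim k (PathAlgebra k V) M (Nakayama k (PathAlgebra k V) P) = 1)
    (f : P →ₗ[PathAlgebra k V] M) (hf : f ≠ 0)
    (g : M →ₗ[PathAlgebra k V] Nakayama k (PathAlgebra k V) P) (hg : g ≠ 0)
    (hBI : homDim k (PathAlgebra k V) (LinearMap.ker g)
      (Nakayama k (PathAlgebra k V) P ⧸ LinearMap.range g) = 0)
    (hPA : homDim k (PathAlgebra k V) (LinearMap.ker f) (M ⧸ LinearMap.range f) = 0) :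
    Module.Projective (PathAlgebra k V) (LinearMap.ker f) ∧
    Module.Injective (PathAlgebra k V)
      (Nakayama k (PathAlgebra k V) P ⧸ LinearMap.range g) ∧
    ccTau N k Λ P * ccModule N k Λ M =
      qHalfPow k (latticeForm Λ (topVec k P) (-coindexVec N k M)) •
        ccShiftInj N k Λ (LinearMap.ker g)
          (Nakayama k (PathAlgebra k V) P ⧸ LinearMap.range g) +
      qHalfPow k (latticeForm Λ (topVec k P) (-coindexVec N k M) - 1) •
        ccShiftProj N k Λ (M ⧸ LinearMap.range f) (LinearMap.ker f) := by
  classical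
  have hfin : Module.Finite k (PathAlgebra k V) := PathAlgebra.finite hV
  refine ⟨(arrowsInjective_ker f).projective hV, (arrowsSurjective_coker g).injective hV, ?_⟩
  have := finite_submodules (V := V) (k := k) M
  have := finite_submodules (V := V) (k := k) (LinearMap.ker g)
  have := finite_submodules (V := V) (k := k) (M ⧸ LinearMap.range f)
  let _ := Fintype.ofFinite (Submodule (PathAlgebra k V) M)
  let _ := Fintype.ofFinite (Submodule (PathAlgebra k V) (LinearMap.ker g))
  let _ := Fintype.ofFinite (Submodule (PathAlgebra k V) (M ⧸ LinearMap.range f))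
  -- The submodules of `ker g` are the submodules of `M` which lie in `ker g`.
  have hB : ccShiftInj N k Λ (LinearMap.ker g)
      (Nakayama k (PathAlgebra k V) P ⧸ LinearMap.range g) =
      ∑ U ∈ Finset.univ.filter (fun U : Submodule (PathAlgebra k V) M => U ≤ LinearMap.ker g),
        ccTerm k N Λ (principalVec k N U) (principalVec k N M) (topVec k P) := by
    rw [ccShiftInj, ccSum_eq_sum, Finset.sum_subtype (p := fun U => U ≤ LinearMap.ker g) _
      (fun U => by simp)]
    refine Fintype.sum_equiv (Submodule.mapIic (LinearMap.ker g)).toEquiv _ _ fun U => ?_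
    have hU : principalVec k N U = principalVec k N (U.map (LinearMap.ker g).subtype) :=
      funext fun i =>
        congrArg Nat.cast (dimVec_congr (Submodule.equivSubtypeMap (LinearMap.ker g) U) i)
    rw [hU]
    exact (ccTerm_of_le_ker Λ hV hM hPM g hg hBI (Submodule.mapIic (LinearMap.ker g) U).2).symm
  -- The submodules of `coker f` are the submodules of `M` which contain `im f`.
  have hA : ccShiftProj N k Λ (M ⧸ LinearMap.range f) (LinearMap.ker f) =
      ∑ U ∈ Finset.univ.filter (fun U : Submodule (PathAlgebra k V) M => LinearMap.range f ≤ U),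
        ccTerm k N Λ (principalVec k N U) (principalVec k N M) (topVec k P) := by
    rw [ccShiftProj, ccSum_eq_sum, Finset.sum_subtype (p := fun U => LinearMap.range f ≤ U) _
      (fun U => by simp)]
    exact Fintype.sum_equiv (Submodule.comapMkQRelIso (LinearMap.range f)).toEquiv _ _ fun W =>
      (ccTerm_comap_mkQ Λ hV hM hPM f hf hPA W).symm
  have hform : ∀ U : Submodule (PathAlgebra k V) M,
      latticeForm Λ (topVec k P) (matB N *ᵥ principalVec k N U) =
        -∑ i, topVec k P i * (dimVec k U i : ℤ) := fun U =>
    latticeForm_matB_mulVec (u := fun i => (dimVec k U i : ℤ)) hcomp _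
      (hM.of_injective U.subtype_injective).dimVec_eq_zero
  have hco : (matI N - matR N) *ᵥ principalVec k N M = coindexVec N k M := rfl
  rw [hA, hB, ccTau_eq, ccModule_eq, ccSum_eq_sum, Finset.mul_sum, Finset.smul_sum,
    Finset.smul_sum, ← Finset.sum_filter_add_sum_filter_not _ (fun U => U ≤ LinearMap.ker g)]
  congr 1
  · refine Finset.sum_congr rfl fun U hU => ?_
    rw [X_mul_ccTerm, hform, sum_topVec_of_le_ker hV hPM hg (Finset.mem_filter.1 hU).2, neg_zero,
      zero_add, hco]
  · refine Finset.sum_congr ?_ fun U hU => ?_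
    · ext U
      simp only [Finset.mem_filter, Finset.mem_univ, true_and]
      exact not_le_ker_iff_range_le hV hPM hf hg U
    · rw [X_mul_ccTerm, hform,
        (sum_topVec_of_range_le hV hPM hf (Finset.mem_filter.1 hU).2).1, hco,
        neg_add_eq_sub]
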